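/- Let $\xi$ be the entire function with $\xi(s)=\pi^{-s/2}\,\Gamma(1+s/2)\,(s-1)\,\zeta(s)$. For complex $s$ and real $\beta\ge 0$ put $$n(s,\beta)=\sin(\pi s/4)\cdot 2\,\xi(2\beta+s),\qquad f(s,\beta)=\frac1{n(s,\beta)},$$ and for integers $w\ge 0$ and complex $z$ put $$P_{4w}(z,\beta)=\frac{(-1)^{w+1}}{\pi^{1-\beta}\,\Gamma(1+\beta)}\sum_{k\ge w+1}\frac{(-1)^k z^{2k}}{(1+\beta)_{2k}\,\bigl(2k+\beta-\tfrac12\bigr)\,\zeta(2\beta+4k)},$$ where $(x)_m=x(x+1)\cdots(x+m-1)$. For real $a<b$ let $V(a,b)=\{s\in\mathbb C: a<\operatorname{Re}s<b\}$, and let $V_{4w}=V(4w,4w+4)$ for every integer $w$. A function $j$ is an *analytic characteristic function* on $V(a,b)$ if it is analytic there and there is a nonzero positive measure $\mu$ on $\mathbb R$ such that $j(s)=\int_{\mathbb R}e^{sy}\,d\mu(y)$, absolutely convergent, for all $s\in V(a,b)$. A function $h$ is a *meromorphic characteristic function* on a set $D\subseteq\mathbb C$ if $h=1/j$ for an entire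 function $j$ such that: every zero of $j$ in $D$ lies on the real or the imaginary axis; if $0\in D$, then $j(0)=0$ and $j(it)=0$ for some real $t\ne0$ with $it\in D$; the real zeros of $j$ in $D$ are simple, and they are unbounded above (respectively below) if $D\cap\mathbb R$ is; and whenever $a<b$ are successive real zeros of $j$, both in $D$, with $V(a,b)\subseteq D$, the function $h$ or $-h$ is an analytic characteristic function on $V(a,b)$. **Lemma 6.2.** Let $\beta\ge 0$ be real. 1. For every integer $w\ge 0$ the series for $P_{4w}(z,\beta)$ converges absolutely for all $z\in\mathbb C$, $P_{4w}(v,\beta)$ is real for real $v$, $P_{4w}(0,\beta)=0$, and $P_{4w}(v,\beta)$ is strictly increasing in $v$ on $[0,\pi]$. 2. For every integer $w\ge 1$, $P_{4w}(v,\beta)>0$ for all $v>0$. 3. For every integer $w\ge1$, $f(s,\beta)$ is analytic on $V_{4w}$, and for $s\in V_{4w}$ $$(-1)^w f(s,\beta)=\int_{\mathbb R}e^{sy}\,P_{4w}(\pi e^{-2y},\beta)\,dy,$$ with absolute convergence; the density $P_{4w}(\pi e^{-2y},\beta)$ is positive for all real $y$. 4. $f(s,\beta)$ is a meromorphic characteristic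 function on $\{s:\operatorname{Re}s\ge 4\}$. 5. If $\beta=1/4$, then for every integer $w\ge1$ and all $s\in V(-4(w+1),-4w)$ $$(-1)^{w+1} f(s,\tfrac14)=\int_{\mathbb R}e^{sy}\,P_{4w}(\pi e^{2y},\tfrac14)\,dy,$$ with absolute convergence, and $f(s,\tfrac14)$ is a meromorphic characteristic function on $\{s:|\operatorname{Re}s|\ge 4\}$. -/

import Mathlib

noncomputable section

namespace ZetaLaplace

/-- The Riemann function `ξ`, i.e. the entire extension of
`(1/2) π^{-s/2} s Γ(s/2) (s - 1) ζ(s) = (1/2) s (s - 1) Λ(s)`. Since Mathlib's `Γ` and `ζ` take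
placeholder values at their poles, `ξ` is written with the entire part `Λ₀` of the completed zeta
function, `Λ(s) = Λ₀(s) - 1/s - 1/(1 - s)`. See `xi_eq` and `differentiable_xi`. -/
def xi (s : ℂ) : ℂ := (s * (s - 1) * completedRiemannZeta₀ s + 1) / 2

theorem differentiable_xi : Differentiable ℂ xi := by
  unfold xi
  have := differentiable_completedZeta₀
  fun_prop

/-- Away from the poles of `ζ` and `Γ(1 + s/2)`, `xi` is `(1/2) · π^{-s/2} 2Γ(1 + s/2) (s-1) ζ(s)`. -/
theorem xi_eq (s : ℂ) (h1 : s ≠ 1) (hs : ∀ k : ℕ, s ≠ -2 * ((k : ℂ) + 1)) :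
    xi s = 1 / 2 * ((Real.pi : ℂ) ^ (-s / 2) * (2 * Complex.Gamma (1 + s / 2)) * (s - 1))
      * riemannZeta s := by
  by_cases h0 : s = 0
  · subst h0
    simp [xi, riemannZeta_zero]
    norm_num
  · have hG : Complex.Gamma (s / 2) ≠ 0 := by
      refine Complex.Gamma_ne_zero fun m hm => ?_
      have hm' : s = -2 * (m : ℂ) := by linear_combination 2 * hm
      cases m with
      | zero => exact h0 (by simpa using hm')
      | succ k => exact hs k (by simpa using hm')
    have hpi : (Real.pi : ℂ) ^ (-s / 2) ≠ 0 := by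
      simp [Complex.cpow_eq_zero_iff, Real.pi_ne_zero]
    have h1' : (1 : ℂ) - s ≠ 0 := sub_ne_zero.mpr (Ne.symm h1)
    rw [riemannZeta_def_of_ne_zero h0, completedRiemannZeta_eq, Complex.Gammaℝ_def, add_comm 1,
      Complex.Gamma_add_one _ (div_ne_zero h0 two_ne_zero), xi]
    field_simp
    ring

/-- `n(s, β) = sin(π s / 4) · 2 ξ(2β + s)`. -/
def n (s β : ℂ) : ℂ := Complex.sin (Real.pi * s / 4) * (2 * xi (2 * β + s))

/-- `f(s, β) = 1 / n(s, β)`. -/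
def f (s β : ℂ) : ℂ := 1 / n s β

/-- The `k`-th term `(-1)^k z^{2k} / ((1+β)_{2k} (2k + β - 1/2) ζ(2β + 4k))` of the series
for `P_{4w}(z, β)`. -/
def PTerm (z β : ℂ) (k : ℕ) : ℂ :=
  (-1) ^ k * z ^ (2 * k) /
    ((ascPochhammer ℂ (2 * k)).eval (1 + β) * (2 * (k : ℂ) + β - 1 / 2)
      * riemannZeta (2 * β + 4 * (k : ℂ)))

/-- `P_{4w}(z, β)`; the sum runs over `k = w + 1 + j ≥ w + 1`. -/
def P (w : ℕ) (z β : ℂ) : ℂ :=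
  (-1) ^ (w + 1) / ((Real.pi : ℂ) ^ (1 - β) * Complex.Gamma (1 + β))
    * ∑' j : ℕ, PTerm z β (w + 1 + j)

/-- The open vertical strip `V(a, b)`. -/
def V (a b : ℝ) : Set ℂ := {s | a < s.re ∧ s.re < b}

/-- `j` is an analytic characteristic function on `V(a, b)`: it is analytic there and is the
absolutely convergent two-sided Laplace transform of a nonzero positive measure on the line. -/
def IsAnalyticCharFun (j : ℂ → ℂ) (a b : ℝ) : Prop :=
  DifferentiableOn ℂ j (V a b) ∧
    ∃ μ : MeasureTheory.Measure ℝ, μ ≠ 0 ∧ ∀ s ∈ V a b,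
      MeasureTheory.Integrable (fun y : ℝ => Complex.exp (s * y)) μ ∧
        j s = ∫ y : ℝ, Complex.exp (s * y) ∂μ

/-- `h` is a meromorphic characteristic function on the domain `D`. For `D = ℂ` this is the notion
of a meromorphic characteristic function on the plane; for a smaller `D`, each condition is
imposed on the part of the plane that lies in `D`. -/
def IsMeromorphicCharFunOn (h : ℂ → ℂ) (D : Set ℂ) : Prop :=
  ∃ j : ℂ → ℂ,
    -- `h` is the reciprocal of an entire function `j`
    Differentiable ℂ j ∧ (∀ z, h z = 1 / j z) ∧
    -- the zeros of `j` in `D` are real or purely imaginary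
    (∀ z ∈ D, j z = 0 → z.im = 0 ∨ z.re = 0) ∧
    -- if `0 ∈ D`, then `j` vanishes at `0` and at some other point of the imaginary axis
    ((0 : ℂ) ∈ D → j 0 = 0 ∧ ∃ t : ℝ, t ≠ 0 ∧ Complex.I * t ∈ D ∧ j (Complex.I * t) = 0) ∧
    -- the real zeros in `D` are unbounded above (below) when the real points of `D` are
    (¬ BddAbove {x : ℝ | (x : ℂ) ∈ D} → ¬ BddAbove {x : ℝ | (x : ℂ) ∈ D ∧ j x = 0}) ∧
    (¬ BddBelow {x : ℝ | (x : ℂ) ∈ D} → ¬ BddBelow {x : ℝ | (x : ℂ) ∈ D ∧ j x = 0}) ∧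
    -- the real zeros in `D` are simple
    (∀ x : ℝ, (x : ℂ) ∈ D → j x = 0 → deriv j x ≠ 0) ∧
    -- on a strip in `D` between successive real zeros, `h` or `-h` is an analytic
    -- characteristic function
    (∀ a b : ℝ, a < b → (a : ℂ) ∈ D → (b : ℂ) ∈ D → V a b ⊆ D → j a = 0 → j b = 0 →
      (∀ x : ℝ, a < x → x < b → j x ≠ 0) →
      IsAnalyticCharFun h a b ∨ IsAnalyticCharFun (fun z => -h z) a b)

end ZetaLaplace

end

/-
The remainder of the cosine series after the terms `k ≤ w` is, up to sign, positive and convex on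
`(0, ∞)` for `w ≥ 1`, and its Mellin transform is explicit because its Laplace transform is a
power of `t` times `1 / (1 + t²)`. Averaging dilates `g (τ v)` against a weight multiplies the
`k`-th coefficient of a power series in `v²` by the moment of `τ` of order `z = 2k`, and the
Mellin transform at `-z` by the moment of order `z`. The beta weight, the weight `t ^ (β - 3/2)`
and the Möbius weight `μ(m) m ^ (-2β)` at `τ = m⁻²` have the moments `Γ(1+z) / Γ(1+β+z)`,
`1 / (z+β-1/2)` and `1 / ζ(2β+2z)`, so the three averages together turn the cosine remainder into
`P_{4w}`, and `v = π exp (-2y)` turns its Mellin transform into the Laplace transform with value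
`±f`.

The first two weights are positive, and they preserve `g (l v) ≤ l g v` for `0 < l ≤ 1`, which
convexity gives for the cosine remainder. Under this inequality the term `m = 1` of the Möbius
average dominates all others together, because `∑_{m ≥ 2} m⁻² < 1`; hence `P_{4w} > 0`.

On `[0, π]`, where `w = 0` is allowed too, each pair of consecutive terms of the alternating
series is increasing. For `β = 1/4` the functional equation makes `n(s, β)` odd in `s`, which
carries everything over to the left half-plane.
-/

open MeasureTheory Set Complex
open scoped Nat Real

namespace ZetaLaplace

section DilateAvg

variable {T : Type*} [MeasurableSpace T] {ν : Measure T} {c τ : T → ℝ} {g : ℝ → ℝ}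

/-- The weighted average `v ↦ ∫ c(t) g(τ(t) v) dν(t)` of the dilates of `g`. -/
noncomputable def dilateAvg (ν : Measure T) (c τ : T → ℝ) (g : ℝ → ℝ) (v : ℝ) : ℝ :=
  ∫ t, c t * g (τ t * v) ∂ν

theorem measurable_dilateAvg [SFinite ν] (hc : Measurable c) (hτ : Measurable τ)
    (hg : Measurable g) : Measurable (dilateAvg ν c τ g) := by
  have : StronglyMeasurable (fun p : ℝ × T => c p.2 * g (τ p.2 * p.1)) :=
    Measurable.stronglyMeasurable (by fun_prop)
  exact this.integral_prod_right.measurable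

theorem integral_norm_cpow_mul (g : ℝ → ℝ) (s : ℂ) :
    ((∫ v in Ioi (0 : ℝ), ‖(v : ℂ) ^ (s - 1) * g v‖ : ℝ) : ℂ) =
      mellin (fun v => ((|g v| : ℝ) : ℂ)) s.re := by
  rw [mellin, ← integral_complex_ofReal]
  refine setIntegral_congr_fun measurableSet_Ioi fun v (hv : 0 < v) => ?_
  simp only [norm_mul, norm_cpow_eq_rpow_re_of_pos hv, smul_eq_mul, Complex.norm_real,
    Real.norm_eq_abs, ofReal_mul, sub_re, one_re, ofReal_cpow hv.le, ofReal_sub, ofReal_one]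

theorem integral_norm_cpow_mul_comp_mul_left (s : ℂ) {a : ℝ} (ha : 0 < a) :
    ∫ v in Ioi (0 : ℝ), ‖(v : ℂ) ^ (s - 1) * (g (a * v) : ℂ)‖ =
      a ^ (-s.re) * ∫ v in Ioi (0 : ℝ), ‖(v : ℂ) ^ (s - 1) * (g v : ℂ)‖ := by
  have h := mellin_comp_mul_left (fun v => ((|g v| : ℝ) : ℂ)) s.re ha
  rw [← integral_norm_cpow_mul (fun v => g (a * v)), ← integral_norm_cpow_mul, smul_eq_mul,
    ← ofReal_neg, ← ofReal_cpow ha.le] at h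
  exact_mod_cast h

theorem integrable_prod_mellin_dilate (hc : Measurable c) (hτ : Measurable τ)
    (hg : Measurable g) (hpos : ∀ᵐ t ∂ν, 0 < τ t) {s : ℂ}
    (hconv : MellinConvergent (fun v => (g v : ℂ)) s)
    (hint : Integrable (fun t => c t * τ t ^ (-s.re)) ν) :
    Integrable (fun p : T × ℝ => (c p.1 : ℂ) * ((p.2 : ℂ) ^ (s - 1) * (g (τ p.1 * p.2) : ℂ)))
      (ν.prod (volume.restrict (Ioi 0))) := by
  have hmeas : Measurable
      (fun p : T × ℝ => (c p.1 : ℂ) * ((p.2 : ℂ) ^ (s - 1) * (g (τ p.1 * p.2) : ℂ))) := by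
    fun_prop
  rw [integrable_prod_iff hmeas.aestronglyMeasurable]
  constructor
  · filter_upwards [hpos] with t ht
    exact Integrable.const_mul
      ((MellinConvergent.comp_mul_left (f := fun v => (g v : ℂ)) ht).2 hconv) _
  · refine (hint.norm.mul_const
      (∫ v in Ioi (0 : ℝ), ‖(v : ℂ) ^ (s - 1) * (g v : ℂ)‖)).congr ?_
    filter_upwards [hpos] with t ht
    simp_rw [norm_mul (c t : ℂ), integral_const_mul, integral_norm_cpow_mul_comp_mul_left s ht,
      norm_mul, Complex.norm_real, Real.norm_of_nonneg (Real.rpow_nonneg ht.le _), mul_assoc]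

theorem hasMellin_dilateAvg [SFinite ν] (hc : Measurable c) (hτ : Measurable τ)
    (hg : Measurable g) (hpos : ∀ᵐ t ∂ν, 0 < τ t) {s m : ℂ}
    (hm : HasMellin (fun v => (g v : ℂ)) s m)
    (hint : Integrable (fun t => c t * τ t ^ (-s.re)) ν) :
    HasMellin (fun v => (dilateAvg ν c τ g v : ℂ)) s
      (m * ∫ t, (c t : ℂ) * (τ t : ℂ) ^ (-s) ∂ν) := by
  have hF := integrable_prod_mellin_dilate hc hτ hg hpos hm.1 hint
  have h_inner (v : ℝ) : ∫ t, (c t : ℂ) * ((v : ℂ) ^ (s - 1) * (g (τ t * v) : ℂ)) ∂ν =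
      (v : ℂ) ^ (s - 1) * (dilateAvg ν c τ g v : ℂ) := by
    rw [dilateAvg, ← integral_complex_ofReal, ← integral_const_mul]
    simp only [ofReal_mul, mul_left_comm]
  refine ⟨?_, ?_⟩
  · simpa only [h_inner] using! hF.integral_prod_right
  · have h_swap := integral_integral_swap (f := fun (t : T) (v : ℝ) =>
      (c t : ℂ) * ((v : ℂ) ^ (s - 1) * (g (τ t * v) : ℂ))) hF
    simp only [h_inner, integral_const_mul] at h_swap
    simp only [mellin, smul_eq_mul]
    rw [← h_swap, ← integral_const_mul]
    refine integral_congr_ae ?_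
    filter_upwards [hpos] with t ht
    have h := mellin_comp_mul_left (fun v => (g v : ℂ)) s ht
    rw [hm.2] at h
    simp only [mellin, smul_eq_mul] at h
    rw [h]
    ring

/-- A weight `c` and a factor `τ ∈ (0, 1]` against which the functions `v ↦ g(τ v)` can be averaged
as soon as `g(τ v) = O(τ)`. -/
structure IsContractionWeight (ν : Measure T) (c τ : T → ℝ) : Prop where
  measurable_weight : Measurable c
  measurable_factor : Measurable τ
  factor_mem : ∀ᵐ t ∂ν, τ t ∈ Ioc 0 1
  integrable_mul : Integrable (fun t => c t * τ t) ν

theorem IsContractionWeight.norm_mul_rpow_le (h : IsContractionWeight ν c τ) {x : ℝ}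
    (hx : 1 ≤ x) : ∀ᵐ t ∂ν, ‖c t * τ t ^ x‖ ≤ ‖c t * τ t‖ := by
  filter_upwards [h.factor_mem] with t ht
  rw [norm_mul, norm_mul, Real.norm_of_nonneg ht.1.le,
    Real.norm_of_nonneg (Real.rpow_nonneg ht.1.le x)]
  gcongr
  simpa using Real.rpow_le_rpow_of_exponent_ge ht.1 ht.2 hx

theorem IsContractionWeight.integrable_mul_rpow (h : IsContractionWeight ν c τ) {x : ℝ}
    (hx : 1 ≤ x) : Integrable (fun t => c t * τ t ^ x) ν :=
  h.integrable_mul.mono (h.measurable_weight.mul (h.measurable_factor.pow_const x)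
    |>.aestronglyMeasurable) (h.norm_mul_rpow_le hx)

theorem hasSum_dilateAvg (h : IsContractionWeight ν c τ) {a : ℕ → ℝ} {p : ℕ → ℕ}
    (hp : ∀ j, 1 ≤ p j) (hs : ∀ x, HasSum (fun j => a j * x ^ p j) (g x)) (v : ℝ) :
    HasSum (fun j => a j * (∫ t, c t * τ t ^ p j ∂ν) * v ^ p j) (dilateAvg ν c τ g v) := by
  have hp' (j : ℕ) : (1 : ℝ) ≤ p j := mod_cast hp j
  have hi (j : ℕ) : Integrable (fun t => c t * τ t ^ p j) ν := by
    simpa only [Real.rpow_natCast] using h.integrable_mul_rpow (hp' j)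
  have hle (j : ℕ) : ∀ᵐ t ∂ν, ‖c t * τ t ^ p j‖ ≤ ‖c t * τ t‖ := by
    simpa only [Real.rpow_natCast] using h.norm_mul_rpow_le (hp' j)
  have hF (j : ℕ) (t : T) :
      c t * (a j * (τ t * v) ^ p j) = c t * τ t ^ p j * (a j * v ^ p j) := by
    rw [mul_pow]; ring
  have h_sum := hasSum_integral_of_summable_integral_norm (μ := ν)
    (F := fun j t => c t * (a j * (τ t * v) ^ p j))
    (fun j => by simp_rw [hF]; exact (hi j).mul_const _) ?_
  · have h_tsum : ∫ t, ∑' j, c t * (a j * (τ t * v) ^ p j) ∂ν = dilateAvg ν c τ g v := by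
      simp_rw [tsum_mul_left, (hs _).tsum_eq, dilateAvg]
    rw [h_tsum] at h_sum
    refine h_sum.congr_fun fun j => ?_
    simp_rw [hF, integral_mul_const]
    ring
  · refine Summable.of_nonneg_of_le (fun j => by positivity) (fun j => ?_)
      ((hs v).summable.norm.mul_left (∫ t, ‖c t * τ t‖ ∂ν))
    simp_rw [hF, norm_mul _ (a j * v ^ p j), integral_mul_const]
    gcongr ?_ * _
    exact integral_mono_ae (hi j).norm h.integrable_mul.norm (hle j)

/-- A measurable function that is positive on `(0, ∞)` and whose epigraph is star-shaped about the
origin there; this is the part of convexity with value `0` at the origin that survives averaging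
over dilates and yields the positivity of the Möbius average. -/
structure IsStarShaped (g : ℝ → ℝ) : Prop where
  measurable : Measurable g
  pos {x : ℝ} : 0 < x → 0 < g x
  le_mul {l x : ℝ} : 0 < l → l ≤ 1 → 0 < x → g (l * x) ≤ l * g x

theorem IsStarShaped.norm_mul_le (hg : IsStarShaped g) {t v : ℝ} (ht : t ∈ Ioc 0 1) (hv : 0 < v)
    (r : ℝ) : ‖r * g (t * v)‖ ≤ ‖r * t‖ * g v := by
  rw [norm_mul, norm_mul, mul_assoc, Real.norm_of_nonneg ht.1.le,
    Real.norm_of_nonneg (hg.pos (mul_pos ht.1 hv)).le]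
  gcongr
  exact hg.le_mul ht.1 ht.2 hv

theorem IsStarShaped.integrable (hg : IsStarShaped g) (h : IsContractionWeight ν c τ)
    {v : ℝ} (hv : 0 < v) : Integrable (fun t => c t * g (τ t * v)) ν := by
  have := hg.measurable
  have := h.measurable_weight
  have := h.measurable_factor
  refine (h.integrable_mul.norm.mul_const (g v)).mono' (by fun_prop) ?_
  filter_upwards [h.factor_mem] with t ht using hg.norm_mul_le ht hv (c t)

theorem dilateAvg_pos (hg : IsStarShaped g) (h : IsContractionWeight ν c τ) (hν : ν ≠ 0)
    (hc : ∀ᵐ t ∂ν, 0 < c t) {v : ℝ} (hv : 0 < v) : 0 < dilateAvg ν c τ g v := by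
  have hpos : ∀ᵐ t ∂ν, 0 < c t * g (τ t * v) := by
    filter_upwards [h.factor_mem, hc] with t ht hct
    exact mul_pos hct (hg.pos (mul_pos ht.1 hv))
  have hsupp : Function.support (fun t => c t * g (τ t * v)) =ᵐ[ν] univ :=
    ae_eq_univ.2 (ae_iff.1 (hpos.mono fun _ ht => ht.ne'))
  refine (integral_pos_iff_support_of_nonneg_ae (hpos.mono fun _ ht => ht.le)
    (hg.integrable h hv)).2 ?_
  rw [measure_congr hsupp]
  exact Measure.measure_univ_pos.2 hν

theorem isStarShaped_dilateAvg [SFinite ν] (hg : IsStarShaped g) (h : IsContractionWeight ν c τ)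
    (hν : ν ≠ 0) (hc : ∀ᵐ t ∂ν, 0 < c t) : IsStarShaped (dilateAvg ν c τ g) where
  measurable := measurable_dilateAvg h.measurable_weight h.measurable_factor hg.measurable
  pos := dilateAvg_pos hg h hν hc
  le_mul {l x} hl hl1 hx := by
    rw [dilateAvg, dilateAvg, ← integral_const_mul]
    refine integral_mono_ae (hg.integrable h (mul_pos hl hx))
      ((hg.integrable h hx).const_mul _) ?_
    filter_upwards [h.factor_mem, hc] with t ht hct
    calc c t * g (τ t * (l * x)) = c t * g (l * (τ t * x)) := by rw [mul_left_comm]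
      _ ≤ c t * (l * g (τ t * x)) := by gcongr; exact hg.le_mul hl hl1 (mul_pos ht.1 hx)
      _ = l * (c t * g (τ t * x)) := by ring

end DilateAvg

section CosineRemainder

/-- The remainder of the cosine series after the terms `k ≤ w`, with the sign that makes it
nonnegative. -/
noncomputable def cosRem (w : ℕ) (v : ℝ) : ℝ :=
  (-1) ^ (w + 1) * (Real.cos v - ∑ k ∈ Finset.range (w + 1), (-1) ^ k * v ^ (2 * k) / (2 * k)!)

/-- The remainder of the sine series after the terms `k < w`, with the sign that makes it
nonnegative on `[0, ∞)` for `w ≥ 1`. -/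
noncomputable def sinRem (w : ℕ) (v : ℝ) : ℝ :=
  (-1) ^ w * (Real.sin v - ∑ k ∈ Finset.range w, (-1) ^ k * v ^ (2 * k + 1) / (2 * k + 1)!)

theorem cosRem_zero (v : ℝ) : cosRem 0 v = 1 - Real.cos v := by simp [cosRem]

theorem sinRem_zero (v : ℝ) : sinRem 0 v = Real.sin v := by simp [sinRem]

theorem cosRem_succ (w : ℕ) (v : ℝ) :
    cosRem (w + 1) v = v ^ (2 * (w + 1)) / (2 * (w + 1))! - cosRem w v := by
  have h_sign : ((-1 : ℝ) ^ (w + 1)) ^ 2 = 1 := by rw [pow_right_comm, neg_one_sq, one_pow]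
  rw [cosRem, cosRem, Finset.sum_range_succ, pow_succ _ (w + 1)]
  linear_combination v ^ (2 * (w + 1)) / (2 * (w + 1))! * h_sign

theorem sinRem_succ (w : ℕ) (v : ℝ) :
    sinRem (w + 1) v = v ^ (2 * w + 1) / (2 * w + 1)! - sinRem w v := by
  have h_sign : ((-1 : ℝ) ^ w) ^ 2 = 1 := by rw [pow_right_comm, neg_one_sq, one_pow]
  rw [sinRem, sinRem, Finset.sum_range_succ, pow_succ]
  linear_combination v ^ (2 * w + 1) / (2 * w + 1)! * h_sign

@[simp] theorem cosRem_apply_zero (w : ℕ) : cosRem w 0 = 0 := by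
  induction w with
  | zero => simp [cosRem_zero]
  | succ w ih => simp [cosRem_succ, ih]

@[simp] theorem sinRem_apply_zero (w : ℕ) : sinRem w 0 = 0 := by simp [sinRem]

theorem hasDerivAt_pow_div_factorial (n : ℕ) (v : ℝ) :
    HasDerivAt (fun v : ℝ => v ^ (n + 1) / (n + 1)!) (v ^ n / n !) v := by
  convert! (hasDerivAt_pow (n + 1) v).div_const ((n + 1)! : ℝ) using 1
  rw [Nat.factorial_succ]
  push_cast
  field_simp

theorem hasDerivAt_cosRem (w : ℕ) (v : ℝ) : HasDerivAt (cosRem w) (sinRem w v) v := by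
  induction w with
  | zero => simpa [funext cosRem_zero, sinRem_zero] using! (Real.hasDerivAt_cos v).const_sub 1
  | succ w ih =>
    rw [sinRem_succ, funext (cosRem_succ w)]
    exact (hasDerivAt_pow_div_factorial (2 * w + 1) v).sub ih

theorem hasDerivAt_sinRem (w : ℕ) (v : ℝ) : HasDerivAt (sinRem (w + 1)) (cosRem w v) v := by
  induction w with
  | zero =>
    simpa [funext (sinRem_succ 0), cosRem_zero, sinRem_zero] using!
      (hasDerivAt_pow_div_factorial 0 v).sub (Real.hasDerivAt_sin v)
  | succ w ih =>
    rw [cosRem_succ, funext (sinRem_succ (w + 1))]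
    exact (hasDerivAt_pow_div_factorial (2 * w + 2) v).sub ih

theorem continuous_cosRem (w : ℕ) : Continuous (cosRem w) :=
  continuous_iff_continuousAt.2 fun v => (hasDerivAt_cosRem w v).continuousAt

theorem continuous_sinRem (w : ℕ) : Continuous (sinRem (w + 1)) :=
  continuous_iff_continuousAt.2 fun v => (hasDerivAt_sinRem w v).continuousAt

theorem cosRem_pos (w : ℕ) {v : ℝ} (hv : 0 < v) : 0 < cosRem (w + 1) v := by
  induction w generalizing v with
  | zero =>
    have := Real.one_sub_sq_div_two_lt_cos hv.ne'
    rw [cosRem_succ, cosRem_zero]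
    norm_num [Nat.factorial]
    linarith
  | succ w ih =>
    have h_sin : StrictMonoOn (sinRem (w + 2)) (Ici 0) := by
      refine strictMonoOn_of_deriv_pos (convex_Ici 0) (continuous_sinRem _).continuousOn ?_
      intro x hx
      rw [(hasDerivAt_sinRem _ x).deriv]
      exact ih (by simpa using hx)
    have h_cos : StrictMonoOn (cosRem (w + 2)) (Ici 0) := by
      refine strictMonoOn_of_deriv_pos (convex_Ici 0) (continuous_cosRem _).continuousOn ?_
      intro x hx
      have hx : 0 < x := by simpa using hx
      rw [(hasDerivAt_cosRem _ x).deriv]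
      simpa using h_sin self_mem_Ici (mem_Ici.2 hx.le) hx
    simpa using h_cos self_mem_Ici (mem_Ici.2 hv.le) hv

theorem cosRem_nonneg (w : ℕ) {v : ℝ} (hv : 0 ≤ v) : 0 ≤ cosRem w v := by
  cases w with
  | zero => simpa [cosRem_zero] using Real.cos_le_one v
  | succ w =>
    rcases hv.eq_or_lt with rfl | h
    · simp
    · exact (cosRem_pos w h).le

theorem convexOn_cosRem (w : ℕ) : ConvexOn ℝ (Ici 0) (cosRem (w + 1)) :=
  convexOn_of_hasDerivWithinAt2_nonneg (convex_Ici 0) (continuous_cosRem _).continuousOn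
    (fun x _ => (hasDerivAt_cosRem _ x).hasDerivWithinAt)
    (fun x _ => (hasDerivAt_sinRem _ x).hasDerivWithinAt)
    (fun _ hx => cosRem_nonneg _ (interior_subset hx))

theorem isStarShaped_cosRem (w : ℕ) : IsStarShaped (cosRem (w + 1)) where
  measurable := (continuous_cosRem _).measurable
  pos := cosRem_pos w
  le_mul {l x} hl hl1 hx := by
    simpa using (convexOn_cosRem w).2 self_mem_Ici (mem_Ici.2 hx.le) (sub_nonneg.2 hl1) hl.le
      (sub_add_cancel 1 l)

theorem hasSum_cosRem (w : ℕ) (v : ℝ) :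
    HasSum (fun j : ℕ => (-1) ^ j / ((2 * (w + 1 + j))! : ℝ) * v ^ (2 * (w + 1 + j)))
      (cosRem w v) := by
  refine (((hasSum_nat_add_iff' (w + 1)).2 (Real.hasSum_cos v)).mul_left
    ((-1) ^ (w + 1))).congr_fun fun j => ?_
  have h_sign : ((-1 : ℝ) ^ (w + 1)) ^ 2 = 1 := by rw [pow_right_comm, neg_one_sq, one_pow]
  rw [add_comm j, pow_add (-1 : ℝ) (w + 1)]
  linear_combination -(-1) ^ j / ((2 * (w + 1 + j))! : ℝ) * v ^ (2 * (w + 1 + j)) * h_sign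

theorem cosRem_le_pow_succ (w : ℕ) {v : ℝ} (hv : 0 ≤ v) :
    cosRem w v ≤ v ^ (2 * (w + 1)) / (2 * (w + 1))! := by
  linarith [cosRem_nonneg (w + 1) hv, cosRem_succ w v]

theorem cosRem_le_two_mul_pow (w : ℕ) {v : ℝ} (hv : 0 ≤ v) :
    cosRem w v ≤ 2 * (v ^ (2 * w) / (2 * w)!) := by
  cases w with
  | zero =>
    norm_num [cosRem_zero]
    linarith [Real.neg_one_le_cos v]
  | succ w =>
    have : 0 ≤ v ^ (2 * (w + 1)) / (2 * (w + 1))! := by positivity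
    linarith [cosRem_nonneg w hv, cosRem_succ w v]

theorem isBigO_cosRem {w k : ℕ} {C : ℝ} {l : Filter ℝ} (hl : ∀ᶠ v in l, 0 < v)
    (hC : ∀ v, 0 ≤ v → cosRem w v ≤ C * (v ^ (2 * k) / (2 * k)!)) :
    (fun v => (cosRem w v : ℂ)) =O[l] fun v : ℝ => v ^ (-(-(2 * k : ℝ))) := by
  refine Asymptotics.IsBigO.of_bound (C / (2 * k)!) ?_
  filter_upwards [hl] with v hv
  have h_rpow : v ^ (-(-(2 * k : ℝ))) = v ^ (2 * k) := by
    rw [neg_neg, ← Real.rpow_natCast]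
    push_cast
    rfl
  rw [Complex.norm_real, Real.norm_of_nonneg (cosRem_nonneg _ hv.le), h_rpow,
    Real.norm_of_nonneg (by positivity)]
  exact (hC v hv.le).trans_eq (by ring)

theorem mellinConvergent_cosRem (w : ℕ) {z : ℂ} (h1 : 2 * w < z.re) (h2 : z.re < 2 * (w + 1)) :
    MellinConvergent (fun v => (cosRem w v : ℂ)) (-z) := by
  refine mellinConvergent_of_isBigO_rpow
    ((continuous_ofReal.comp (continuous_cosRem w)).continuousOn.locallyIntegrableOn
      measurableSet_Ioi)
    (isBigO_cosRem (Filter.eventually_gt_atTop 0) fun v => cosRem_le_two_mul_pow w) ?_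
    (isBigO_cosRem (k := w + 1) (C := 1) self_mem_nhdsWithin fun v hv => ?_) ?_
  · simpa using h1
  · simpa using cosRem_le_pow_succ w hv
  · simpa using h2

end CosineRemainder

section LaplaceTransform

theorem hasMellin_exp_neg {s : ℂ} (hs : 0 < s.re) :
    HasMellin (fun v : ℝ => (Real.exp (-v) : ℂ)) s (Gamma s) := by
  refine ⟨(GammaIntegral_convergent hs).congr_fun (fun v _ => ?_) measurableSet_Ioi, ?_⟩
  · simp [mul_comm]
  · rw [Gamma_eq_integral hs, GammaIntegral_eq_mellin]

/-- The Laplace transform averages the dilates of `v ↦ exp (-v)`. -/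
theorem hasMellin_laplace {c : ℝ → ℝ} (hc : Measurable c) {s : ℂ} (hs : 0 < s.re)
    (hconv : MellinConvergent (fun t => (c t : ℂ)) (1 - s)) :
    HasMellin (fun v : ℝ => ((∫ t in Ioi (0 : ℝ), c t * Real.exp (-(t * v)) : ℝ) : ℂ)) s
      (Gamma s * mellin (fun t => (c t : ℂ)) (1 - s)) := by
  have h_cpow (t : ℝ) : (c t : ℂ) * (t : ℂ) ^ (-s) = (t : ℂ) ^ (1 - s - 1) • (c t : ℂ) := by
    rw [smul_eq_mul, mul_comm, show 1 - s - 1 = -s by ring]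
  have h_int : Integrable (fun t : ℝ => c t * t ^ (-s.re)) (volume.restrict (Ioi 0)) := by
    refine Integrable.mono hconv (by fun_prop) ?_
    filter_upwards [self_mem_ae_restrict measurableSet_Ioi] with t ht
    rw [← h_cpow, norm_mul, norm_mul, norm_cpow_eq_rpow_re_of_pos ht, Complex.norm_real,
      Real.norm_of_nonneg (Real.rpow_nonneg (le_of_lt ht) _), neg_re]
  have := hasMellin_dilateAvg hc measurable_id (by fun_prop : Measurable fun v => Real.exp (-v))
    (self_mem_ae_restrict measurableSet_Ioi) (hasMellin_exp_neg hs) h_int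
  simpa only [dilateAvg, id, h_cpow] using! this

theorem laplace_exp_neg {v : ℝ} (hv : 0 < v) :
    ∫ t in Ioi (0 : ℝ), Real.exp (-t) * Real.exp (-(t * v)) = (1 + v)⁻¹ := by
  have (t : ℝ) : Real.exp (-t) * Real.exp (-(t * v)) = Real.exp (-(1 + v) * t) := by
    rw [← Real.exp_add]; ring_nf
  simp_rw [this]
  rw [integral_exp_mul_Ioi (by linarith), mul_zero, Real.exp_zero, neg_div_neg_eq, one_div]

theorem hasMellin_congr {p q : ℝ → ℂ} {s m : ℂ} (hp : HasMellin p s m)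
    (hpq : EqOn p q (Ioi 0)) : HasMellin q s m := by
  refine ⟨hp.1.congr_fun (fun v hv => ?_) measurableSet_Ioi, ?_⟩
  · simp only [hpq hv]
  · rw [← hp.2]
    exact setIntegral_congr_fun measurableSet_Ioi fun v hv => by simp only [hpq hv]

theorem hasMellin_inv_one_add {s : ℂ} (h0 : 0 < s.re) (h1 : s.re < 1) :
    HasMellin (fun v : ℝ => (((1 + v)⁻¹ : ℝ) : ℂ)) s (π / sin (π * s)) := by
  have h_exp := hasMellin_exp_neg (s := 1 - s) (by simpa using h1)
  have h := hasMellin_laplace (by fun_prop) h0 h_exp.1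
  rw [h_exp.2, Gamma_mul_Gamma_one_sub] at h
  exact hasMellin_congr h fun v hv => by simp only [laplace_exp_neg hv]

theorem hasMellin_inv_one_add_sq {s : ℂ} (h0 : 0 < s.re) (h1 : s.re < 2) :
    HasMellin (fun v : ℝ => (((1 + v ^ 2)⁻¹ : ℝ) : ℂ)) s (π / 2 / sin (π * s / 2)) := by
  have h := hasMellin_inv_one_add (s := s / (2 : ℝ))
    (by simp only [div_ofReal_re]; linarith)
    (by simp only [div_ofReal_re]; linarith)
  have hc := (MellinConvergent.comp_rpow (f := fun v : ℝ => (((1 + v)⁻¹ : ℝ) : ℂ)) (s := s)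
    (a := 2) two_ne_zero).2 h.1
  have hm := mellin_comp_rpow (fun v : ℝ => (((1 + v)⁻¹ : ℝ) : ℂ)) s 2
  rw [h.2] at hm
  simp only [Real.rpow_two] at hc hm
  refine ⟨hc, hm.trans ?_⟩
  rw [abs_of_pos two_pos, Complex.real_smul]
  push_cast
  rw [mul_div_assoc (π : ℂ)]
  ring

theorem integrableOn_pow_div_factorial_mul_exp_neg (n : ℕ) {t : ℝ} (ht : 0 < t) :
    IntegrableOn (fun v : ℝ => v ^ n / n ! * Real.exp (-(t * v))) (Ioi 0) := by
  have h := integrableOn_rpow_mul_exp_neg_mul_rpow (p := 1) (s := n) (b := t)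
    (neg_one_lt_zero.trans_le n.cast_nonneg) one_pos ht
  simp_rw [div_mul_eq_mul_div]
  simpa using! h.div_const (n ! : ℝ)

theorem laplace_pow_div_factorial (n : ℕ) {t : ℝ} (ht : 0 < t) :
    ∫ v in Ioi (0 : ℝ), v ^ n / n ! * Real.exp (-(t * v)) = t⁻¹ ^ (n + 1) := by
  have h := Real.integral_rpow_mul_exp_neg_mul_Ioi (a := n + 1) (r := t) (by positivity) ht
  rw [add_sub_cancel_right, Real.Gamma_nat_eq_factorial, ← Nat.cast_succ, Real.rpow_natCast,
    one_div] at h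
  simp_rw [Real.rpow_natCast] at h
  simp_rw [div_mul_eq_mul_div, integral_div, h]
  field_simp

theorem re_exp_neg_add_I_mul (t v : ℝ) :
    (cexp ((-(t : ℂ) + I) * v)).re = Real.cos v * Real.exp (-(t * v)) := by
  simp [Complex.exp_re, mul_comm]

theorem integrableOn_cos_mul_exp_neg {t : ℝ} (ht : 0 < t) :
    IntegrableOn (fun v => Real.cos v * Real.exp (-(t * v))) (Ioi 0) := by
  have ha : (-(t : ℂ) + I).re < 0 := by simpa using ht
  simpa [re_exp_neg_add_I_mul] using! (integrableOn_exp_mul_complex_Ioi ha 0).re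

theorem laplace_cos {t : ℝ} (ht : 0 < t) :
    ∫ v in Ioi (0 : ℝ), Real.cos v * Real.exp (-(t * v)) = t / (1 + t ^ 2) := by
  have ha : (-(t : ℂ) + I).re < 0 := by simpa using ht
  have h := integral_re (integrableOn_exp_mul_complex_Ioi ha 0)
  simp only [RCLike.re_eq_complex_re, re_exp_neg_add_I_mul,
    integral_exp_mul_complex_Ioi ha 0] at h
  rw [h]
  simp [Complex.div_re, Complex.normSq_apply]
  field_simp
  ring

theorem integrableOn_cosRem_mul_exp_neg (w : ℕ) {t : ℝ} (ht : 0 < t) :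
    IntegrableOn (fun v => cosRem w v * Real.exp (-(t * v))) (Ioi 0) := by
  induction w with
  | zero =>
    simp only [cosRem_zero, sub_mul]
    simpa using! (integrableOn_pow_div_factorial_mul_exp_neg 0 ht).sub
      (integrableOn_cos_mul_exp_neg ht)
  | succ w ih =>
    simp only [cosRem_succ, sub_mul]
    exact (integrableOn_pow_div_factorial_mul_exp_neg _ ht).sub ih

theorem laplace_cosRem (w : ℕ) {t : ℝ} (ht : 0 < t) :
    ∫ v in Ioi (0 : ℝ), cosRem w v * Real.exp (-(t * v)) =
      t⁻¹ ^ (2 * w + 1) * (1 + t ^ 2)⁻¹ := by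
  induction w with
  | zero =>
    have h_one := laplace_pow_div_factorial 0 ht
    have h_int := integrableOn_pow_div_factorial_mul_exp_neg 0 ht
    simp only [pow_zero, Nat.factorial_zero, Nat.cast_one, div_one, one_mul] at h_one h_int
    simp only [cosRem_zero, sub_mul, one_mul]
    rw [integral_sub h_int (integrableOn_cos_mul_exp_neg ht), h_one, laplace_cos ht, inv_pow]
    field_simp
    ring
  | succ w ih =>
    simp only [cosRem_succ, sub_mul]
    rw [integral_sub (integrableOn_pow_div_factorial_mul_exp_neg _ ht)
      (integrableOn_cosRem_mul_exp_neg w ht), ih, laplace_pow_div_factorial _ ht,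
      inv_pow, inv_pow]
    field_simp
    ring

theorem mellin_laplace_cosRem (w : ℕ) {z : ℂ} (h1 : 2 * w < z.re) (h2 : z.re < 2 * (w + 1)) :
    mellin (fun v => ((∫ t in Ioi (0 : ℝ), cosRem w t * Real.exp (-(t * v)) : ℝ) : ℂ)) (1 + z) =
      π / 2 / sin (π * (z - 2 * w) / 2) := by
  rw [← (hasMellin_inv_one_add_sq (s := z - 2 * w) (by simpa using h1)
      (by simp; linarith)).2,
    show z - 2 * (w : ℂ) = (1 + z) + (-(2 * w + 1 : ℕ) : ℂ) by push_cast; ring,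
    ← mellin_cpow_smul _ (1 + z)]
  refine setIntegral_congr_fun measurableSet_Ioi fun v hv => ?_
  simp_rw [mul_comm _ v, laplace_cosRem w hv]
  rw [Complex.cpow_neg, Complex.cpow_natCast]
  simp only [inv_pow, smul_eq_mul, ofReal_mul, ofReal_inv, ofReal_pow, ofReal_add, ofReal_one]

theorem hasMellin_cosRem (w : ℕ) {z : ℂ} (h1 : 2 * w < z.re) (h2 : z.re < 2 * (w + 1)) :
    HasMellin (fun v => (cosRem w v : ℂ)) (-z)
      ((-1) ^ w * (π / 2) / sin (π * z / 2) * (Gamma (1 + z))⁻¹) := by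
  have hz : 0 < (1 + z).re := by
    have := w.cast_nonneg (α := ℝ)
    simp only [add_re, one_re]
    linarith
  have h_sin : sin (π * (z - 2 * w) / 2) = (-1) ^ w * sin (π * z / 2) := by
    rw [show (π : ℂ) * (z - 2 * w) / 2 = π * z / 2 - w * π by ring]
    exact Complex.sin_antiperiodic.sub_nat_mul_eq _
  have h_conv := mellinConvergent_cosRem w h1 h2
  have h_laplace : Gamma (1 + z) * mellin (fun v => (cosRem w v : ℂ)) (-z) =
      π / 2 / ((-1) ^ w * sin (π * z / 2)) := by
    rw [← h_sin, ← mellin_laplace_cosRem w h1 h2]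
    rw [show -z = 1 - (1 + z) by ring] at h_conv ⊢
    exact (hasMellin_laplace (continuous_cosRem w).measurable hz h_conv).2.symm
  refine ⟨h_conv, ?_⟩
  rw [eq_mul_inv_iff_mul_eq₀ (Gamma_ne_zero_of_re_pos hz), mul_comm, h_laplace, div_mul_eq_div_div,
    div_eq_mul_inv _ ((-1 : ℂ) ^ w), ← inv_pow, inv_neg_one, mul_comm]

end LaplaceTransform

section MasterKernel

/-- `g` is the alternating power series with coefficients `A (2k)`, `k > w`, and its Mellin
transform is the one that Ramanujan's master theorem predicts from `A`. -/
structure IsMasterKernel (w : ℕ) (A : ℂ → ℂ) (g : ℝ → ℝ) : Prop where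
  measurable : Measurable g
  hasSum (v : ℝ) : HasSum (fun j : ℕ =>
    (-1) ^ j * (A (2 * (w + 1 + j) : ℕ)).re * v ^ (2 * (w + 1 + j))) (g v)
  hasMellin (z : ℂ) : 2 * w < z.re → z.re < 2 * (w + 1) →
    HasMellin (fun v => (g v : ℂ)) (-z) ((-1) ^ w * (π / 2) / sin (π * z / 2) * A z)

variable {w : ℕ} {A : ℂ → ℂ} {g : ℝ → ℝ}

theorem IsMasterKernel.congr {B : ℂ → ℂ} (hg : IsMasterKernel w A g) (hw : 1 ≤ w)
    (hAB : ∀ z : ℂ, 1 ≤ z.re → A z = B z) : IsMasterKernel w B g where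
  measurable := hg.measurable
  hasSum v := by
    convert hg.hasSum v using 5 with j
    refine (hAB _ ?_).symm
    rw [natCast_re]
    exact_mod_cast (by omega : 1 ≤ 2 * (w + 1 + j))
  hasMellin z h1 h2 := by
    have hw' : (1 : ℝ) ≤ w := mod_cast hw
    rw [← hAB z (by linarith)]
    exact hg.hasMellin z h1 h2

theorem IsMasterKernel.const_mul (hg : IsMasterKernel w A g) (r : ℝ) :
    IsMasterKernel w (fun z => r * A z) (fun v => r * g v) where
  measurable := hg.measurable.const_mul r
  hasSum v := by
    refine ((hg.hasSum v).mul_left r).congr_fun fun j => ?_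
    rw [re_ofReal_mul]
    ring
  hasMellin z h1 h2 := by
    convert hasMellin_const_smul (hg.hasMellin z h1 h2).1 (r : ℂ) using 1
    · funext v
      simp
    · rw [(hg.hasMellin z h1 h2).2, smul_eq_mul, mul_left_comm]

theorem isMasterKernel_cosRem (w : ℕ) :
    IsMasterKernel w (fun z => (Gamma (1 + z))⁻¹) (cosRem w) where
  measurable := (continuous_cosRem w).measurable
  hasSum v := by
    convert hasSum_cosRem w v using 3 with j
    rw [add_comm 1, Gamma_nat_eq_factorial, ← ofReal_natCast, ← ofReal_inv, ofReal_re,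
      div_eq_mul_inv]
  hasMellin _ := hasMellin_cosRem w

variable {T : Type*} [MeasurableSpace T] {ν : Measure T} {c τ : T → ℝ} {M : ℂ → ℂ}

/-- The contraction weight `c`, `τ` has the complex moments `∫ c τ ^ z dν = M z`. -/
structure HasMoments (ν : Measure T) (c τ : T → ℝ) (M : ℂ → ℂ) : Prop
    extends IsContractionWeight ν c τ where
  integral_eq (z : ℂ) : 1 ≤ z.re → ∫ t, (c t : ℂ) * (τ t : ℂ) ^ z ∂ν = M z

theorem HasMoments.natCast (h : HasMoments ν c τ M) {n : ℕ} (hn : 1 ≤ n) :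
    M n = ((∫ t, c t * τ t ^ n ∂ν : ℝ) : ℂ) := by
  rw [← h.integral_eq n (by simpa using hn), ← integral_complex_ofReal]
  simp

theorem isMasterKernel_dilateAvg [SFinite ν] (hw : 1 ≤ w) (hg : IsMasterKernel w A g)
    (h : HasMoments ν c τ M) : IsMasterKernel w (fun z => A z * M z) (dilateAvg ν c τ g) where
  measurable := measurable_dilateAvg h.measurable_weight h.measurable_factor hg.measurable
  hasSum v := by
    convert hasSum_dilateAvg h.toIsContractionWeight
      (fun j : ℕ => (by omega : 1 ≤ 2 * (w + 1 + j))) hg.hasSum v using 3 with j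
    rw [h.natCast (by omega), re_mul_ofReal]
    ring
  hasMellin z h1 h2 := by
    have hw' : (1 : ℝ) ≤ w := mod_cast hw
    have := hasMellin_dilateAvg h.measurable_weight h.measurable_factor hg.measurable
      (h.factor_mem.mono fun t ht => ht.1) (hg.hasMellin z h1 h2)
      (by simpa using h.integrable_mul_rpow (x := z.re) (by linarith))
    rwa [neg_neg, h.integral_eq z (by linarith), mul_assoc] at this

theorem hasMoments_rpow {β : ℝ} (hβ : -1 / 2 < β) :
    HasMoments (volume.restrict (Ioo (0 : ℝ) 1)) (fun t => t ^ (β - 3 / 2)) (fun t => t)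
      (fun z => (z + β - 1 / 2)⁻¹) where
  measurable_weight := by fun_prop
  measurable_factor := by fun_prop
  factor_mem := ae_restrict_of_forall_mem measurableSet_Ioo fun t ht => ⟨ht.1, ht.2.le⟩
  integrable_mul := by
    have h : IntervalIntegrable (fun t : ℝ => t ^ (β - 3 / 2 + 1)) volume 0 1 :=
      intervalIntegral.intervalIntegrable_rpow' (by linarith)
    rw [intervalIntegrable_iff_integrableOn_Ioo_of_le zero_le_one] at h
    exact h.congr_fun (fun t ht => Real.rpow_add_one ht.1.ne' _) measurableSet_Ioo
  integral_eq z hz := by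
    have hre : -1 < ((β - 3 / 2 : ℝ) + z : ℂ).re := by
      rw [add_re, ofReal_re]
      linarith
    have hne : ((β - 3 / 2 : ℝ) + z + 1 : ℂ) ≠ 0 := by
      refine ne_zero_of_re_pos ?_
      rw [add_re, one_re]
      linarith
    have h := integral_cpow (a := 0) (b := 1) (Or.inl hre)
    rw [intervalIntegral.integral_of_le zero_le_one, integral_Ioc_eq_integral_Ioo, ofReal_one,
      one_cpow, ofReal_zero, zero_cpow hne, sub_zero] at h
    rw [show z + β - 1 / 2 = ((β - 3 / 2 : ℝ) + z + 1 : ℂ) by push_cast; ring, ← one_div, ← h]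
    refine setIntegral_congr_fun measurableSet_Ioo fun t ht => ?_
    rw [cpow_add _ _ (ofReal_ne_zero.2 ht.1.ne'), ofReal_cpow ht.1.le]

theorem integral_beta_mul_cpow (β : ℝ) (z : ℂ) :
    ∫ t in Ioo (0 : ℝ) 1, (((1 - t) ^ (β - 1) / Real.Gamma β : ℝ) : ℂ) * (t : ℂ) ^ z =
      betaIntegral (1 + z) β / Gamma β := by
  rw [betaIntegral, intervalIntegral.integral_of_le zero_le_one, integral_Ioc_eq_integral_Ioo,
    ← integral_div]
  refine setIntegral_congr_fun measurableSet_Ioo fun t ht => ?_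
  rw [ofReal_div, ofReal_cpow (sub_pos.2 ht.2).le, ← Gamma_ofReal, add_sub_cancel_left]
  push_cast
  ring

theorem hasMoments_beta {β : ℝ} (hβ : 0 < β) :
    HasMoments (volume.restrict (Ioo (0 : ℝ) 1)) (fun t => (1 - t) ^ (β - 1) / Real.Gamma β)
      (fun t => t) (fun z => Gamma (1 + z) / Gamma (1 + β + z)) where
  measurable_weight := by fun_prop
  measurable_factor := by fun_prop
  factor_mem := ae_restrict_of_forall_mem measurableSet_Ioo fun t ht => ⟨ht.1, ht.2.le⟩
  integrable_mul := by
    have h := betaIntegral_convergent (u := ((1 + 1 : ℝ) : ℂ)) (v := (β : ℂ))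
      (by rw [ofReal_re]; norm_num) (by simpa using hβ)
    rw [intervalIntegrable_iff_integrableOn_Ioo_of_le zero_le_one] at h
    refine IntegrableOn.congr_fun (h.norm.div_const (Real.Gamma β)) (fun t ht => ?_)
      measurableSet_Ioo
    rw [norm_mul, norm_cpow_eq_rpow_re_of_pos ht.1, ← ofReal_one, ← ofReal_sub 1 t,
      norm_cpow_eq_rpow_re_of_pos (sub_pos.2 ht.2), ← ofReal_sub, ← ofReal_sub, ofReal_re,
      ofReal_re, add_sub_cancel_right, Real.rpow_one]
    ring
  integral_eq z hz := by
    have h := Gamma_mul_Gamma_eq_betaIntegral (s := 1 + z) (t := (β : ℂ))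
      (by rw [add_re, one_re]; linarith) (by simpa using hβ)
    have hG : Gamma (1 + β + z) ≠ 0 := by
      refine Gamma_ne_zero_of_re_pos ?_
      simp only [add_re, one_re, ofReal_re]
      linarith
    have hGβ : Gamma (β : ℂ) ≠ 0 := Gamma_ne_zero_of_re_pos (by simpa using hβ)
    rw [integral_beta_mul_cpow, div_eq_div_iff hGβ hG, mul_comm, h, add_right_comm]

theorem volume_restrict_Ioo_zero_one_ne_zero : volume.restrict (Ioo (0 : ℝ) 1) ≠ 0 := by
  simp [Measure.restrict_eq_zero]

theorem exists_isMasterKernel_inv_Gamma {w : ℕ} (hw : 1 ≤ w) {β : ℝ} (hβ : 0 ≤ β) :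
    ∃ g, IsStarShaped g ∧ IsMasterKernel w (fun z => (Gamma (1 + β + z))⁻¹) g := by
  have h_star : IsStarShaped (cosRem w) := by
    obtain ⟨w, rfl⟩ := Nat.exists_eq_add_of_le' hw
    exact isStarShaped_cosRem w
  rcases hβ.eq_or_lt with rfl | hβ
  · exact ⟨_, h_star, by simpa using isMasterKernel_cosRem w⟩
  · have hM := hasMoments_beta hβ
    refine ⟨_, isStarShaped_dilateAvg h_star hM.toIsContractionWeight
      volume_restrict_Ioo_zero_one_ne_zero ?_,
      (isMasterKernel_dilateAvg hw (isMasterKernel_cosRem w) hM).congr hw fun z hz => ?_⟩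
    · filter_upwards [self_mem_ae_restrict measurableSet_Ioo] with t ht
      exact div_pos (Real.rpow_pos_of_pos (sub_pos.2 ht.2) _) (Real.Gamma_pos_of_pos hβ)
    · have : Gamma (1 + z) ≠ 0 := Gamma_ne_zero_of_re_pos (by rw [add_re, one_re]; linarith)
      field_simp

theorem exists_isMasterKernel {w : ℕ} (hw : 1 ≤ w) {β : ℝ} (hβ : 0 ≤ β) :
    ∃ g, IsStarShaped g ∧
      IsMasterKernel w (fun z => (Gamma (1 + β + z))⁻¹ * (z + β - 1 / 2)⁻¹) g := by
  obtain ⟨g, h_star, hg⟩ := exists_isMasterKernel_inv_Gamma hw hβ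
  have hM := hasMoments_rpow (β := β) (by linarith)
  refine ⟨_, isStarShaped_dilateAvg h_star hM.toIsContractionWeight
    volume_restrict_Ioo_zero_one_ne_zero ?_, isMasterKernel_dilateAvg hw hg hM⟩
  filter_upwards [self_mem_ae_restrict measurableSet_Ioo] with t ht
  exact Real.rpow_pos_of_pos ht.1 _

end MasterKernel

section Zeta

theorem riemannZeta_ofReal {x : ℝ} (hx : 1 < x) :
    riemannZeta x = ((∑' n : ℕ, 1 / (n : ℝ) ^ x : ℝ) : ℂ) := by
  rw [zeta_eq_tsum_one_div_nat_cpow (by simpa using hx), ofReal_tsum]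
  refine tsum_congr fun n => ?_
  rw [ofReal_div, ofReal_cpow n.cast_nonneg]
  simp

theorem ofReal_re_riemannZeta {x : ℝ} (hx : 1 < x) :
    ((riemannZeta x).re : ℂ) = riemannZeta x := by
  rw [riemannZeta_ofReal hx, ofReal_re]

theorem one_le_re_riemannZeta {x : ℝ} (hx : 1 < x) : 1 ≤ (riemannZeta x).re := by
  rw [riemannZeta_ofReal hx, ofReal_re]
  simpa using (Real.summable_one_div_nat_rpow.2 hx).le_tsum 1 fun n _ => by positivity

theorem re_riemannZeta_le {x : ℝ} (hx : 4 ≤ x) : (riemannZeta x).re ≤ π ^ 4 / 90 := by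
  rw [riemannZeta_ofReal (by linarith), ofReal_re, ← hasSum_zeta_four.tsum_eq]
  refine Summable.tsum_le_tsum (fun n => ?_) (Real.summable_one_div_nat_rpow.2 (by linarith))
    hasSum_zeta_four.summable
  rcases Nat.eq_zero_or_pos n with rfl | hn
  · simp [Real.zero_rpow (by linarith : x ≠ 0)]
  · have : (n : ℝ) ^ 4 ≤ (n : ℝ) ^ x := by
      rw [← Real.rpow_natCast]
      exact Real.rpow_le_rpow_of_exponent_le (mod_cast hn) (mod_cast hx)
    gcongr

theorem pi_sq_lt : π ^ 2 < 9.87 := by nlinarith [Real.pi_lt_d4, Real.pi_pos]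

theorem pi_sq_mul_re_riemannZeta_lt {x : ℝ} (hx : 4 ≤ x) :
    π ^ 2 * (riemannZeta x).re < 11 := by
  have hpi := pi_sq_lt
  calc π ^ 2 * (riemannZeta x).re ≤ π ^ 2 * (π ^ 4 / 90) := by gcongr; exact re_riemannZeta_le hx
    _ = (π ^ 2) ^ 3 / 90 := by ring
    _ < 9.87 ^ 3 / 90 := by gcongr
    _ < 11 := by norm_num

theorem hasSum_riemannZeta_inv {s : ℂ} (hs : 1 < s.re) :
    HasSum (fun n : ℕ => (ArithmeticFunction.moebius (n + 1) : ℂ) * ((n : ℂ) + 1) ^ (-s))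
      (riemannZeta s)⁻¹ := by
  have h_mul := ArithmeticFunction.LSeries_zeta_mul_Lseries_moebius hs
  rw [ArithmeticFunction.LSeries_zeta_eq_riemannZeta hs] at h_mul
  have h_sum := (ArithmeticFunction.LSeriesSummable_moebius_iff.2 hs).LSeriesHasSum
  rw [eq_inv_of_mul_eq_one_right h_mul] at h_sum
  have h_shift := (hasSum_nat_add_iff' 1).2 h_sum
  simp only [Finset.range_one, Finset.sum_singleton, LSeries.term_zero, sub_zero] at h_shift
  refine h_shift.congr_fun fun n => ?_
  rw [LSeries.term_of_ne_zero n.succ_ne_zero, cpow_neg, div_eq_mul_inv, Nat.cast_succ]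

end Zeta

section Moebius

theorem integral_count_eq_tsum {E : Type*} [NormedAddCommGroup E] [NormedSpace ℝ E]
    [CompleteSpace E] {f : ℕ → E} (hf : Summable fun n => ‖f n‖) :
    ∫ n, f n ∂Measure.count = ∑' n, f n := by
  rw [integral_countable (integrable_count_iff.2 hf)]
  simp [Measure.real]

theorem dilateAvg_count_pos {g : ℝ → ℝ} (hg : IsStarShaped g) {c τ : ℕ → ℝ}
    (h : IsContractionWeight Measure.count c τ) (hc : c 0 = 1) (hτ : τ 0 = 1)
    (h_tail : ∑' n, ‖c (n + 1) * τ (n + 1)‖ < 1) {v : ℝ} (hv : 0 < v) :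
    0 < dilateAvg Measure.count c τ g v := by
  have h_weight : Summable fun n => ‖c n * τ n‖ := integrable_count_iff.1 h.integrable_mul
  have h_sum : Summable fun n => ‖c n * g (τ n * v)‖ :=
    integrable_count_iff.1 (hg.integrable h hv)
  have h_le : ‖∑' n, c (n + 1) * g (τ (n + 1) * v)‖ ≤ (∑' n, ‖c (n + 1) * τ (n + 1)‖) * g v := by
    rw [← tsum_mul_right]
    refine tsum_of_norm_bounded (((summable_nat_add_iff 1).2 h_weight).mul_right _).hasSum
      fun n => hg.norm_mul_le (Measure.ae_count_iff.1 h.factor_mem _) hv _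
  have h_lt : (∑' n, ‖c (n + 1) * τ (n + 1)‖) * g v < g v :=
    mul_lt_of_lt_one_left (hg.pos hv) h_tail
  rw [dilateAvg, integral_count_eq_tsum h_sum, h_sum.of_norm.tsum_eq_zero_add, hc, hτ, one_mul,
    one_mul]
  linarith [neg_le_of_abs_le h_le]

/-- The weight `μ(m) m ^ (-2β)` at `m = n + 1`. -/
noncomputable def moebiusWeight (β : ℝ) (n : ℕ) : ℝ :=
  ArithmeticFunction.moebius (n + 1) * (n + 1 : ℝ) ^ (-2 * β)

/-- The dilation factor `m ^ (-2)` at `m = n + 1`, which goes with `moebiusWeight`. -/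
noncomputable def moebiusFactor (n : ℕ) : ℝ := ((n + 1 : ℝ) ^ 2)⁻¹

theorem moebiusFactor_mem_Ioc (n : ℕ) : moebiusFactor n ∈ Ioc 0 1 :=
  ⟨by unfold moebiusFactor; positivity,
    inv_le_one_of_one_le₀ (one_le_pow₀ (le_add_of_nonneg_left n.cast_nonneg))⟩

theorem moebiusWeight_mul_moebiusFactor_cpow (β : ℝ) (z : ℂ) (n : ℕ) :
    (moebiusWeight β n : ℂ) * (moebiusFactor n : ℂ) ^ z =
      ArithmeticFunction.moebius (n + 1) * ((n : ℂ) + 1) ^ (-(2 * β + 2 * z)) := by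
  have h_nonneg : (0 : ℝ) ≤ n + 1 := by positivity
  have h_ne : (n : ℂ) + 1 ≠ 0 := n.cast_add_one_ne_zero
  have h_factor : moebiusFactor n = (n + 1 : ℝ) ^ (-2 : ℝ) := by
    rw [moebiusFactor, Real.rpow_neg h_nonneg, Real.rpow_two]
  rw [h_factor, ← cpow_mul_ofReal_nonneg h_nonneg, moebiusWeight, ofReal_mul,
    ofReal_cpow h_nonneg, neg_add, cpow_add _ _ h_ne]
  push_cast
  ring_nf

theorem summable_norm_moebiusWeight_mul_cpow {β : ℝ} {z : ℂ} (h : 1 < 2 * β + 2 * z.re) :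
    Summable fun n => ‖(moebiusWeight β n : ℂ) * (moebiusFactor n : ℂ) ^ z‖ := by
  simp_rw [moebiusWeight_mul_moebiusFactor_cpow]
  exact (hasSum_riemannZeta_inv (s := 2 * β + 2 * z) (by simpa using h)).summable.norm

theorem hasMoments_moebius {β : ℝ} (hβ : -1 / 2 < β) :
    HasMoments Measure.count (moebiusWeight β) moebiusFactor
      (fun z => (riemannZeta (2 * β + 2 * z))⁻¹) where
  measurable_weight := measurable_of_countable _
  measurable_factor := measurable_of_countable _
  factor_mem := .of_forall moebiusFactor_mem_Ioc
  integrable_mul := by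
    refine integrable_count_iff.2 ((summable_norm_moebiusWeight_mul_cpow (β := β) (z := 1)
      (by rw [one_re]; linarith)).congr fun n => ?_)
    rw [cpow_one, ← ofReal_mul, Complex.norm_real]
  integral_eq z hz := by
    have h_re : 1 < 2 * β + 2 * z.re := by linarith
    rw [integral_count_eq_tsum (summable_norm_moebiusWeight_mul_cpow h_re)]
    simp_rw [moebiusWeight_mul_moebiusFactor_cpow]
    exact (hasSum_riemannZeta_inv (by simpa using h_re)).tsum_eq

theorem norm_moebiusWeight_mul_le {β : ℝ} (hβ : 0 ≤ β) (n : ℕ) :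
    ‖moebiusWeight β n * moebiusFactor n‖ ≤ 1 / (n + 1 : ℝ) ^ 2 := by
  have h_one_le : (1 : ℝ) ≤ n + 1 := le_add_of_nonneg_left n.cast_nonneg
  have h_moebius : |(ArithmeticFunction.moebius (n + 1) : ℝ)| ≤ 1 :=
    mod_cast ArithmeticFunction.abs_moebius_le_one
  have h_rpow : (n + 1 : ℝ) ^ (-2 * β) ≤ 1 :=
    Real.rpow_le_one_of_one_le_of_nonpos h_one_le (by linarith)
  rw [moebiusWeight, norm_mul, norm_mul, Real.norm_eq_abs,
    Real.norm_of_nonneg (Real.rpow_nonneg (zero_le_one.trans h_one_le) _),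
    Real.norm_of_nonneg (moebiusFactor_mem_Ioc n).1.le, moebiusFactor, ← one_div]
  exact mul_le_of_le_one_left (by positivity) (mul_le_one₀ h_moebius (by positivity) h_rpow)

theorem tsum_norm_moebiusWeight_mul_lt_one {β : ℝ} (hβ : 0 ≤ β) :
    ∑' n, ‖moebiusWeight β (n + 1) * moebiusFactor (n + 1)‖ < 1 := by
  have h_zeta : HasSum (fun n : ℕ => 1 / ((n + 1 : ℕ) + 1 : ℝ) ^ 2) (π ^ 2 / 6 - 1) := by
    have h := (hasSum_nat_add_iff' 2).2 hasSum_zeta_two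
    simpa [Finset.sum_range_succ, add_assoc, one_add_one_eq_two] using h
  have h_le (n : ℕ) := norm_moebiusWeight_mul_le hβ (n + 1)
  calc ∑' n, ‖moebiusWeight β (n + 1) * moebiusFactor (n + 1)‖ ≤ π ^ 2 / 6 - 1 :=
        h_zeta.tsum_eq ▸ Summable.tsum_le_tsum h_le (.of_nonneg_of_le (fun _ => norm_nonneg _)
          h_le h_zeta.summable) h_zeta.summable
    _ < 1 := by linarith [pi_sq_lt]

theorem dilateAvg_moebius_pos {g : ℝ → ℝ} (hg : IsStarShaped g) {β : ℝ} (hβ : 0 ≤ β)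
    {v : ℝ} (hv : 0 < v) : 0 < dilateAvg Measure.count (moebiusWeight β) moebiusFactor g v :=
  dilateAvg_count_pos hg (hasMoments_moebius (by linarith)).toIsContractionWeight
    (by simp [moebiusWeight]) (by simp [moebiusFactor]) (tsum_norm_moebiusWeight_mul_lt_one hβ) hv

end Moebius

section Series

/-- The coefficient `1 / ((1+β)_{2k} (2k + β - 1/2) ζ(2β + 4k))` in the series for `P`. -/
noncomputable def coeff (β : ℝ) (k : ℕ) : ℝ :=
  1 / ((ascPochhammer ℝ (2 * k)).eval (1 + β) * (2 * k + β - 1 / 2)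
    * (riemannZeta ((2 * β + 4 * k : ℝ) : ℂ)).re)

/-- `P_{4w}(v, β)` as a real function of the real variable `v`; see `P_ofReal`. -/
noncomputable def realP (w : ℕ) (β v : ℝ) : ℝ :=
  1 / (π ^ (1 - β) * Real.Gamma (1 + β)) *
    ∑' j : ℕ, (-1) ^ j * coeff β (w + 1 + j) * v ^ (2 * (w + 1 + j))

theorem ascPochhammer_eval_ofReal (x : ℝ) (n : ℕ) :
    (ascPochhammer ℂ n).eval (x : ℂ) = (((ascPochhammer ℝ n).eval x : ℝ) : ℂ) := by
  rw [← ascPochhammer_map Complex.ofRealHom]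
  exact Polynomial.eval_map_apply Complex.ofRealHom x

theorem factorial_le_ascPochhammer {x : ℝ} (hx : 1 ≤ x) (n : ℕ) :
    (n ! : ℝ) ≤ (ascPochhammer ℝ n).eval x := by
  induction n with
  | zero => simp
  | succ n ih =>
    rw [ascPochhammer_succ_eval, Nat.factorial_succ, mul_comm, Nat.cast_mul, Nat.cast_succ]
    exact mul_le_mul ih (by linarith) (by positivity) ((Nat.cast_nonneg _).trans ih)

theorem ascPochhammer_two_mul_succ_eval (x : ℝ) (k : ℕ) :
    (ascPochhammer ℝ (2 * (k + 1))).eval x =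
      (ascPochhammer ℝ (2 * k)).eval x * ((x + 2 * k) * (x + 2 * k + 1)) := by
  rw [show 2 * (k + 1) = 2 * k + 1 + 1 from rfl, ascPochhammer_succ_eval, ascPochhammer_succ_eval]
  push_cast
  ring

variable {β : ℝ} {k : ℕ}

theorem four_le_two_mul_add (hβ : 0 ≤ β) (hk : 1 ≤ k) : 4 ≤ 2 * β + 4 * k := by
  have : (1 : ℝ) ≤ k := mod_cast hk
  linarith

theorem coeff_pos (hβ : 0 ≤ β) (hk : 1 ≤ k) : 0 < coeff β k := by
  have h_arg := four_le_two_mul_add hβ hk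
  have h_zeta := one_le_re_riemannZeta (x := 2 * β + 4 * k) (by linarith)
  have h_linear : 0 < 2 * k + β - 1 / 2 := by linarith
  have h_asc := ascPochhammer_pos (2 * k) (1 + β) (by linarith)
  unfold coeff
  positivity

theorem coeff_le (hβ : 0 ≤ β) (hk : 1 ≤ k) : coeff β k ≤ 1 / (2 * k)! := by
  have h_arg := four_le_two_mul_add hβ hk
  have h_zeta := one_le_re_riemannZeta (x := 2 * β + 4 * k) (by linarith)
  have h_linear : 1 ≤ 2 * k + β - 1 / 2 := by linarith
  have h_asc := factorial_le_ascPochhammer (x := 1 + β) (by linarith) (2 * k)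
  have h_fact : (0 : ℝ) < (2 * k)! := by positivity
  refine one_div_le_one_div_of_le h_fact (h_asc.trans ?_)
  rw [mul_assoc]
  exact le_mul_of_one_le_right (h_fact.le.trans h_asc)
    (one_le_mul_of_one_le_of_one_le h_linear h_zeta)

theorem PTerm_eq (hβ : 0 ≤ β) (hk : 1 ≤ k) (z : ℂ) :
    PTerm z β k = (-1) ^ k * z ^ (2 * k) * coeff β k := by
  have h_zeta := ofReal_re_riemannZeta (x := 2 * β + 4 * k)
    (by linarith [four_le_two_mul_add hβ hk])
  have h_asc := ascPochhammer_eval_ofReal (1 + β) (2 * k)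
  rw [coeff, PTerm]
  push_cast at h_zeta h_asc ⊢
  rw [h_zeta, h_asc]
  ring

theorem summable_norm_PTerm (hβ : 0 ≤ β) (w : ℕ) (z : ℂ) :
    Summable fun j : ℕ => ‖PTerm z β (w + 1 + j)‖ := by
  have h_exp := (Real.summable_pow_div_factorial ‖z‖).comp_injective
    (i := fun j : ℕ => 2 * (w + 1 + j)) fun a b h => by simpa using h
  refine h_exp.of_nonneg_of_le (fun j => norm_nonneg _) fun j => ?_
  have hk : 1 ≤ w + 1 + j := by omega
  rw [PTerm_eq hβ hk, norm_mul, norm_mul, norm_pow, norm_pow, norm_neg, norm_one, one_pow,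
    one_mul, Complex.norm_real, Real.norm_of_nonneg (coeff_pos hβ hk).le, Function.comp_apply,
    div_eq_mul_one_div]
  gcongr
  exact coeff_le hβ hk

theorem summable_realP (hβ : 0 ≤ β) (w : ℕ) (v : ℝ) :
    Summable fun j : ℕ => (-1) ^ j * coeff β (w + 1 + j) * v ^ (2 * (w + 1 + j)) := by
  refine .of_norm ((summable_norm_PTerm hβ w v).congr fun j => ?_)
  rw [PTerm_eq hβ (by omega)]
  simp only [norm_mul, norm_pow, norm_neg, norm_one, one_pow, one_mul, Complex.norm_real]
  ring

theorem P_ofReal (hβ : 0 ≤ β) (w : ℕ) (v : ℝ) : P w v β = (realP w β v : ℂ) := by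
  have h_term (j : ℕ) : PTerm v β (w + 1 + j) = (-1) ^ (w + 1) *
      (((-1) ^ j * coeff β (w + 1 + j) * v ^ (2 * (w + 1 + j)) : ℝ) : ℂ) := by
    rw [PTerm_eq hβ (by omega), pow_add (-1 : ℂ) (w + 1)]
    push_cast
    ring
  have h_sign : ((-1 : ℂ) ^ (w + 1)) * (-1) ^ (w + 1) = 1 := by
    rw [← mul_pow, neg_one_mul, neg_neg, one_pow]
  rw [P, realP, tsum_congr h_term, tsum_mul_left, ← mul_assoc, div_mul_eq_mul_div, h_sign,
    ofReal_mul, ofReal_tsum, ofReal_div, ofReal_mul, ofReal_cpow Real.pi_nonneg, ← Gamma_ofReal]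
  push_cast
  rfl

theorem realP_zero (w : ℕ) (β : ℝ) : realP w β 0 = 0 := by
  simp [realP]

end Series

section Monotone

variable {β : ℝ} {k : ℕ}

theorem eleven_mul_le (hβ : 0 ≤ β) (hk : 1 ≤ k) :
    11 * ((k + 1) * (2 * k + β - 1 / 2)) ≤
      k * ((1 + β + 2 * k) * (1 + β + 2 * k + 1) * (2 * (k + 1) + β - 1 / 2)) := by
  obtain ⟨m, rfl⟩ := Nat.exists_eq_add_of_le' hk
  rw [← sub_nonneg]
  push_cast
  ring_nf
  positivity

theorem succ_mul_coeff_succ_mul_pi_sq_lt (hβ : 0 ≤ β) (hk : 1 ≤ k) :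
    (k + 1) * coeff β (k + 1) * π ^ 2 < k * coeff β k := by
  have h_arg := four_le_two_mul_add hβ hk
  have h_zeta := one_le_re_riemannZeta (x := 2 * β + 4 * k) (by linarith)
  have h_zeta' := one_le_re_riemannZeta (x := 2 * β + 4 * (k + 1 : ℕ)) (by push_cast; linarith)
  have h_pi := pi_sq_mul_re_riemannZeta_lt h_arg
  have h_poly := eleven_mul_le hβ hk
  have h_linear : 0 < 2 * k + β - 1 / 2 := by linarith
  have h_linear' : 0 < 2 * (k + 1) + β - 1 / 2 := by linarith
  have h_asc := ascPochhammer_pos (2 * k) (1 + β) (by linarith)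
  rw [coeff, coeff, ascPochhammer_two_mul_succ_eval, Nat.cast_succ] at *
  set A := (ascPochhammer ℝ (2 * k)).eval (1 + β)
  set B := (1 + β + 2 * k) * (1 + β + 2 * k + 1)
  set Z := (riemannZeta ((2 * β + 4 * k : ℝ) : ℂ)).re
  set Z' := (riemannZeta ((2 * β + 4 * (k + 1) : ℝ) : ℂ)).re
  have : 0 < B := by positivity
  rw [mul_one_div, mul_one_div, div_mul_eq_mul_div, div_lt_div_iff₀ (by positivity)
    (by positivity)]
  calc (k + 1) * π ^ 2 * (A * (2 * k + β - 1 / 2) * Z)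
      = A * ((k + 1) * (2 * k + β - 1 / 2)) * (π ^ 2 * Z) := by ring
    _ < A * ((k + 1) * (2 * k + β - 1 / 2)) * 11 := by gcongr
    _ = A * (11 * ((k + 1) * (2 * k + β - 1 / 2))) := by ring
    _ ≤ A * (k * (B * (2 * (k + 1) + β - 1 / 2))) := by gcongr
    _ ≤ A * (k * (B * (2 * (k + 1) + β - 1 / 2))) * Z' :=
        le_mul_of_one_le_right (by positivity) h_zeta'
    _ = k * (A * B * (2 * (k + 1) + β - 1 / 2) * Z') := by ring

theorem strictMonoOn_coeff_sub_coeff_succ (hβ : 0 ≤ β) (hk : 1 ≤ k) :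
    StrictMonoOn (fun v : ℝ => coeff β k * v ^ (2 * k) - coeff β (k + 1) * v ^ (2 * (k + 1)))
      (Icc 0 π) := by
  refine strictMonoOn_of_deriv_pos (convex_Icc _ _) (by fun_prop) fun x hx => ?_
  rw [interior_Icc] at hx
  have h_deriv : HasDerivAt
      (fun v : ℝ => coeff β k * v ^ (2 * k) - coeff β (k + 1) * v ^ (2 * (k + 1)))
      (coeff β k * ((2 * k : ℕ) * x ^ (2 * k - 1)) -
        coeff β (k + 1) * ((2 * (k + 1) : ℕ) * x ^ (2 * (k + 1) - 1))) x :=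
    ((hasDerivAt_pow _ x).const_mul _).sub ((hasDerivAt_pow _ x).const_mul _)
  have h_coeff : (k + 1) * coeff β (k + 1) * x ^ 2 < k * coeff β k := by
    refine (mul_le_mul_of_nonneg_left (pow_le_pow_left₀ hx.1.le hx.2.le 2) ?_).trans_lt
      (succ_mul_coeff_succ_mul_pi_sq_lt hβ hk)
    have := coeff_pos hβ (k := k + 1) (by omega)
    positivity
  have h_pos : 0 < 2 * x ^ (2 * k - 1) * (k * coeff β k - (k + 1) * coeff β (k + 1) * x ^ 2) :=
    mul_pos (mul_pos two_pos (pow_pos hx.1 _)) (sub_pos.2 h_coeff)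
  rw [h_deriv.deriv, show 2 * (k + 1) - 1 = (2 * k - 1) + 2 by omega, pow_add]
  push_cast
  linarith

theorem hasSum_pairs {a : ℕ → ℝ} (ha : Summable fun j => (-1) ^ j * a j) :
    HasSum (fun i => a (2 * i) - a (2 * i + 1)) (∑' j, (-1) ^ j * a j) := by
  have h_even : Summable fun i : ℕ => (-1) ^ (2 * i) * a (2 * i) :=
    ha.comp_injective (mul_right_injective₀ two_ne_zero)
  have h_odd : Summable fun i : ℕ => (-1) ^ (2 * i + 1) * a (2 * i + 1) :=
    ha.comp_injective ((add_left_injective 1).comp (mul_right_injective₀ two_ne_zero))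
  rw [← tsum_even_add_odd (f := fun j => (-1) ^ j * a j) h_even h_odd]
  refine (h_even.hasSum.add h_odd.hasSum).congr_fun fun i => ?_
  rw [pow_succ, pow_mul, neg_one_sq, one_pow]
  ring

theorem strictMonoOn_realP (hβ : 0 ≤ β) (w : ℕ) : StrictMonoOn (realP w β) (Icc 0 π) := by
  intro x hx y hy hxy
  have h_const : 0 < 1 / (π ^ (1 - β) * Real.Gamma (1 + β)) := by
    have := Real.Gamma_pos_of_pos (by linarith : 0 < 1 + β)
    positivity
  have h_pairs (v : ℝ) := hasSum_pairs ((summable_realP hβ w v).congr fun j => mul_assoc _ _ _)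
  have h_lt (i : ℕ) := strictMonoOn_coeff_sub_coeff_succ hβ
    (by omega : 1 ≤ w + 1 + 2 * i) hx hy hxy
  refine mul_lt_mul_of_pos_left ?_ h_const
  simp only [mul_assoc]
  exact hasSum_lt (fun i => (h_lt i).le) (i := 0) (h_lt 0) (h_pairs x) (h_pairs y)

end Monotone

section PKernel

/-- The function of `z` whose values at `z = 2k` are, up to the factor `Γ(1+β)`, the coefficients
`coeff β k`. -/
noncomputable def masterCoeff (β : ℝ) (z : ℂ) : ℂ :=
  (Gamma (1 + β + z))⁻¹ * (z + β - 1 / 2)⁻¹ * (riemannZeta (2 * β + 2 * z))⁻¹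

variable {β : ℝ} {w k : ℕ}

theorem Gamma_add_natCast {x : ℝ} (hx : 0 < x) (n : ℕ) :
    Gamma (x + n) = ((Real.Gamma x * (ascPochhammer ℝ n).eval x : ℝ) : ℂ) := by
  have hx' : 0 < (x : ℂ).re := by rwa [ofReal_re]
  have h_ratio := Gamma_add_nat_div_Gamma_eq (n := n) (x : ℂ) fun m hm => by
    rw [hm, neg_re, natCast_re] at hx'
    exact absurd (neg_pos.1 hx') (not_lt.2 m.cast_nonneg)
  rw [div_eq_iff (Gamma_ne_zero_of_re_pos hx'), ascPochhammer_eval_ofReal] at h_ratio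
  rw [h_ratio, ofReal_mul, Gamma_ofReal, mul_comm]

theorem masterCoeff_two_mul (hβ : 0 ≤ β) (hk : 1 ≤ k) :
    masterCoeff β (2 * k : ℕ) = (((Real.Gamma (1 + β))⁻¹ * coeff β k : ℝ) : ℂ) := by
  have h_Gamma := Gamma_add_natCast (by linarith : 0 < 1 + β) (2 * k)
  have h_zeta := ofReal_re_riemannZeta (x := 2 * β + 4 * k)
    (by linarith [four_le_two_mul_add hβ hk])
  have h_arg : 2 * (β : ℂ) + 2 * (2 * k) = 2 * β + 4 * k := by ring
  rw [masterCoeff, coeff]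
  push_cast at h_Gamma h_zeta ⊢
  rw [h_Gamma, h_arg, h_zeta]
  simp only [mul_inv, one_div]
  ring

theorem realP_eq_of_isMasterKernel (hβ : 0 ≤ β) {g : ℝ → ℝ}
    (hg : IsMasterKernel w (masterCoeff β) g) (v : ℝ) : realP w β v = π ^ (β - 1) * g v := by
  rw [← (hg.hasSum v).tsum_eq, realP, one_div, mul_inv, ← Real.rpow_neg Real.pi_nonneg, neg_sub,
    mul_assoc, ← tsum_mul_left]
  congr 2
  funext j
  rw [masterCoeff_two_mul hβ (by omega), ofReal_re]
  ring

theorem exists_realP_eq_dilateAvg (hβ : 0 ≤ β) (hw : 1 ≤ w) :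
    ∃ g, IsStarShaped g ∧
      IsMasterKernel w (masterCoeff β)
        (dilateAvg Measure.count (moebiusWeight β) moebiusFactor g) ∧
      realP w β =
        fun v => π ^ (β - 1) * dilateAvg Measure.count (moebiusWeight β) moebiusFactor g v := by
  obtain ⟨g, h_star, hg⟩ := exists_isMasterKernel hw hβ
  have h_kernel := isMasterKernel_dilateAvg hw hg (hasMoments_moebius (β := β) (by linarith))
  exact ⟨g, h_star, h_kernel, funext (realP_eq_of_isMasterKernel hβ h_kernel)⟩

theorem isMasterKernel_realP (hβ : 0 ≤ β) (hw : 1 ≤ w) :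
    IsMasterKernel w (fun z => (π ^ (β - 1) : ℝ) * masterCoeff β z) (realP w β) := by
  obtain ⟨g, -, h_kernel, h_eq⟩ := exists_realP_eq_dilateAvg hβ hw
  exact h_eq ▸ h_kernel.const_mul _

theorem realP_pos (hβ : 0 ≤ β) (hw : 1 ≤ w) {v : ℝ} (hv : 0 < v) : 0 < realP w β v := by
  obtain ⟨g, h_star, -, h_eq⟩ := exists_realP_eq_dilateAvg hβ hw
  rw [h_eq]
  exact mul_pos (Real.rpow_pos_of_pos Real.pi_pos _) (dilateAvg_moebius_pos h_star hβ hv)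

end PKernel

section Substitution

variable {p : ℝ → ℂ} {s m : ℂ}

theorem cexp_mul_ofReal (z : ℂ) (y : ℝ) : cexp (z * y) = (Real.exp y : ℂ) ^ z := by
  rw [ofReal_exp, mul_comm, cpow_def_of_ne_zero (exp_ne_zero _), ← ofReal_exp,
    ← ofReal_log (Real.exp_pos y).le, Real.log_exp]

theorem integrable_and_integral_cexp_mul_comp_exp (h : HasMellin p s m) :
    Integrable (fun y : ℝ => cexp (s * y) * p (Real.exp y)) ∧
      ∫ y : ℝ, cexp (s * y) * p (Real.exp y) = m := by
  have h_deriv (y : ℝ) (_ : y ∈ univ) : HasDerivWithinAt Real.exp (Real.exp y) univ y :=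
    (Real.hasDerivAt_exp y).hasDerivWithinAt
  have h_eq (y : ℝ) : |Real.exp y| • (Real.exp y : ℂ) ^ (s - 1) • p (Real.exp y) =
      cexp (s * y) * p (Real.exp y) := by
    have h_ne : (Real.exp y : ℂ) ≠ 0 := ofReal_ne_zero.2 (Real.exp_ne_zero y)
    rw [cexp_mul_ofReal, abs_of_pos (Real.exp_pos y), real_smul, smul_eq_mul, ← mul_assoc,
      cpow_sub _ _ h_ne, cpow_one, mul_div_cancel₀ _ h_ne]
  have h_integrable := integrableOn_image_iff_integrableOn_abs_deriv_smul MeasurableSet.univ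
    h_deriv Real.exp_injective.injOn fun v : ℝ => (v : ℂ) ^ (s - 1) • p v
  have h_integral := integral_image_eq_integral_abs_deriv_smul MeasurableSet.univ
    h_deriv Real.exp_injective.injOn fun v : ℝ => (v : ℂ) ^ (s - 1) • p v
  simp only [image_univ, Real.range_exp, h_eq, integrableOn_univ, Measure.restrict_univ]
    at h_integrable h_integral
  exact ⟨h_integrable.1 h.1, h_integral.symm.trans h.2⟩

theorem integrable_and_integral_cexp_mul_comp_pi_mul_exp (h : HasMellin p (-(s / 2)) m) :
    Integrable (fun y : ℝ => cexp (s * y) * p (π * Real.exp (-2 * y))) ∧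
      ∫ y : ℝ, cexp (s * y) * p (π * Real.exp (-2 * y)) = (π : ℂ) ^ (s / 2) / 2 * m := by
  have h_exponent : s / ((-2 : ℝ) : ℂ) = -(s / 2) := by
    push_cast
    ring
  have h_mellin : HasMellin (fun t : ℝ => p (π * t ^ (-2 : ℝ))) s ((π : ℂ) ^ (s / 2) / 2 * m) := by
    constructor
    · refine (MellinConvergent.comp_rpow (f := fun t => p (π * t)) (by norm_num)).2 ?_
      rw [h_exponent, MellinConvergent.comp_mul_left Real.pi_pos]
      exact h.1
    · rw [mellin_comp_rpow (fun t => p (π * t)), h_exponent, mellin_comp_mul_left _ _ Real.pi_pos,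
        h.2, neg_neg, abs_neg, abs_two, real_smul, smul_eq_mul]
      push_cast
      ring
  have h_exp (y : ℝ) : Real.exp (-2 * y) = Real.exp y ^ (-2 : ℝ) := by
    rw [← Real.exp_mul, mul_comm]
  simp only [h_exp]
  exact integrable_and_integral_cexp_mul_comp_exp h_mellin

end Substitution

section Xi

theorem xi_eq_of_one_lt_re {s : ℂ} (hs : 1 < s.re) :
    xi s = 1 / 2 * ((π : ℂ) ^ (-s / 2) * (2 * Gamma (1 + s / 2)) * (s - 1)) * riemannZeta s := by
  refine xi_eq s (fun h => by simp [h] at hs) fun k hk => ?_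
  have h_re : s.re = -2 * (k + 1) := by simpa using congrArg re hk
  linarith [(k.cast_nonneg : (0 : ℝ) ≤ k)]

theorem xi_ne_zero {s : ℂ} (hs : 1 < s.re) : xi s ≠ 0 := by
  have h_one : s - 1 ≠ 0 := sub_ne_zero.2 fun h => by simp [h] at hs
  have h_Gamma : Gamma (1 + s / 2) ≠ 0 := by
    refine Gamma_ne_zero_of_re_pos ?_
    rw [add_re, one_re, div_ofNat_re]
    linarith
  have h_pi : (π : ℂ) ^ (-s / 2) ≠ 0 := by simp [cpow_eq_zero_iff, Real.pi_ne_zero]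
  have h_zeta := riemannZeta_ne_zero_of_one_lt_re hs
  rw [xi_eq_of_one_lt_re hs]
  simp [h_one, h_Gamma, h_pi, h_zeta]

theorem one_lt_re_two_mul_add {β : ℝ} (hβ : 0 ≤ β) {s : ℂ} (hs : 1 < s.re) :
    1 < (2 * β + s : ℂ).re := by
  have h_re : (2 * β + s : ℂ).re = 2 * β + s.re := by simp
  linarith

theorem xi_two_mul_add_ne_zero {β : ℝ} (hβ : 0 ≤ β) {s : ℂ} (hs : 1 < s.re) :
    xi (2 * β + s) ≠ 0 :=
  xi_ne_zero (one_lt_re_two_mul_add hβ hs)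

theorem xi_one_sub (s : ℂ) : xi (1 - s) = xi s := by
  rw [xi, xi, completedRiemannZeta₀_one_sub]
  ring

end Xi

section Zeros

variable {s β : ℂ}

theorem differentiable_n (β : ℂ) : Differentiable ℂ fun s => n s β := by
  have := differentiable_xi
  unfold n
  fun_prop

theorem sin_pi_mul_div_four_eq_zero_iff : sin (π * s / 4) = 0 ↔ ∃ m : ℤ, s = 4 * m := by
  have h_pi : (π : ℂ) ≠ 0 := ofReal_ne_zero.2 Real.pi_ne_zero
  rw [Complex.sin_eq_zero_iff]
  refine exists_congr fun m => ?_
  rw [div_eq_iff (by norm_num), mul_comm (m : ℂ), mul_assoc, mul_right_inj' h_pi, mul_comm (m : ℂ)]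

theorem n_eq_zero_iff (h_xi : xi (2 * β + s) ≠ 0) : n s β = 0 ↔ ∃ m : ℤ, s = 4 * m := by
  rw [← sin_pi_mul_div_four_eq_zero_iff, n, mul_eq_zero,
    or_iff_left (mul_ne_zero two_ne_zero h_xi)]

theorem n_four_mul (m : ℤ) (β : ℂ) : n (4 * m) β = 0 := by
  rw [n, sin_pi_mul_div_four_eq_zero_iff.2 ⟨m, rfl⟩, zero_mul]

theorem deriv_n_ne_zero (h_xi : xi (2 * β + s) ≠ 0) (h_zero : n s β = 0) :
    deriv (fun s => n s β) s ≠ 0 := by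
  have h_sin : sin (π * s / 4) = 0 :=
    sin_pi_mul_div_four_eq_zero_iff.2 ((n_eq_zero_iff h_xi).1 h_zero)
  have h_cos : cos (π * s / 4) ≠ 0 := by
    intro h_cos
    simpa [h_sin, h_cos] using Complex.sin_sq_add_cos_sq (π * s / 4)
  have h_arg : HasDerivAt (fun s : ℂ => (π : ℂ) * s / 4) (π / 4) s := by
    simpa using ((hasDerivAt_id s).const_mul (π : ℂ)).div_const 4
  have h_xi_diff : DifferentiableAt ℂ (fun s => 2 * xi (2 * β + s)) s := by
    have := differentiable_xi
    fun_prop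
  have h_deriv : deriv (fun s => n s β) s = cos (π * s / 4) * (π / 4) * (2 * xi (2 * β + s)) :=
    (h_arg.csin.fun_mul h_xi_diff.hasDerivAt).deriv.trans (by rw [h_sin, zero_mul, add_zero])
  rw [h_deriv]
  simp [h_cos, h_xi, Real.pi_ne_zero]

theorem n_ne_zero_of_mem_V {m : ℤ} (h_xi : xi (2 * β + s) ≠ 0) (hs : s ∈ V (4 * m) (4 * (m + 1))) :
    n s β ≠ 0 := by
  rw [Ne, n_eq_zero_iff h_xi]
  rintro ⟨k, rfl⟩
  have h_re : (4 * (k : ℂ)).re = 4 * k := by simp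
  obtain ⟨h_left, h_right⟩ := hs
  rw [h_re, mul_lt_mul_iff_right₀ four_pos] at h_left h_right
  norm_cast at h_left h_right
  omega

theorem differentiableOn_f {m : ℤ} (h_xi : ∀ s ∈ V (4 * m) (4 * (m + 1)), xi (2 * β + s) ≠ 0) :
    DifferentiableOn ℂ (fun s => f s β) (V (4 * m) (4 * (m + 1))) :=
  .div (differentiableOn_const 1) (differentiable_n β).differentiableOn
    fun s hs => n_ne_zero_of_mem_V (h_xi s hs) hs

end Zeros

section Laplace

variable {β : ℝ} {w : ℕ}

theorem one_lt_re_of_mem_V (hw : 1 ≤ w) {s : ℂ} (hs : s ∈ V (4 * w) (4 * (w + 1))) :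
    1 < s.re := by
  have hw' : (1 : ℝ) ≤ w := mod_cast hw
  linarith [hs.1]

theorem differentiableOn_f_V (hβ : 0 ≤ β) (hw : 1 ≤ w) :
    DifferentiableOn ℂ (fun s => f s β) (V (4 * w) (4 * (w + 1))) :=
  differentiableOn_f (m := w) fun _ hs => xi_two_mul_add_ne_zero hβ (one_lt_re_of_mem_V hw hs)

theorem f_eq_masterCoeff (hβ : 0 ≤ β) {s : ℂ} (hs : 1 < s.re) :
    f s β = (π : ℂ) ^ (s / 2) / 2 *
      (π / 2 / sin (π * (s / 2) / 2) * ((π ^ (β - 1) : ℝ) * masterCoeff β (s / 2))) := by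
  have h_pi : (π : ℂ) ≠ 0 := ofReal_ne_zero.2 Real.pi_ne_zero
  have h_cpow : (π : ℂ) ^ (-(2 * β + s) / 2) =
      ((π : ℂ) ^ (s / 2) * (π : ℂ) ^ (β - 1 : ℂ) * π)⁻¹ := by
    nth_rewrite 4 [← cpow_one (π : ℂ)]
    rw [← cpow_add _ _ h_pi, ← cpow_add _ _ h_pi, ← cpow_neg]
    ring_nf
  have h_zeta_arg : 2 * (β : ℂ) + 2 * (s / 2) = 2 * β + s := by ring
  have h_linear : s / 2 + (β : ℂ) - 1 / 2 = (2 * β + s - 1) / 2 := by ring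
  have h_Gamma_arg : (1 : ℂ) + β + s / 2 = 1 + (2 * β + s) / 2 := by ring
  have h_sin_arg : (π : ℂ) * (s / 2) / 2 = π * s / 4 := by ring
  rw [f, n, xi_eq_of_one_lt_re (one_lt_re_two_mul_add hβ hs), masterCoeff, h_cpow, h_zeta_arg,
    h_linear, h_Gamma_arg, h_sin_arg, ofReal_cpow Real.pi_nonneg, ofReal_sub, ofReal_one]
  simp only [div_eq_mul_inv, mul_inv, inv_inv, one_mul]
  ring

theorem integrable_and_f_eq_integral (hβ : 0 ≤ β) (hw : 1 ≤ w) {s : ℂ}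
    (hs : s ∈ V (4 * w) (4 * (w + 1))) :
    Integrable (fun y : ℝ => cexp (s * y) * P w ((π * Real.exp (-2 * y) : ℝ) : ℂ) β) ∧
      (-1) ^ w * f s β = ∫ y : ℝ, cexp (s * y) * P w ((π * Real.exp (-2 * y) : ℝ) : ℂ) β := by
  have h_re : (s / 2).re = s.re / 2 := div_ofNat_re s 2
  have h_mellin := (isMasterKernel_realP hβ hw).hasMellin (s / 2) (by rw [h_re]; linarith [hs.1])
    (by rw [h_re]; linarith [hs.2])
  obtain ⟨h_integrable, h_integral⟩ := integrable_and_integral_cexp_mul_comp_pi_mul_exp h_mellin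
  simp only [P_ofReal hβ]
  refine ⟨h_integrable, ?_⟩
  rw [h_integral, f_eq_masterCoeff hβ (one_lt_re_of_mem_V hw hs)]
  ring

end Laplace

section CharFun

theorem isAnalyticCharFun_of_density {j : ℂ → ℂ} {a b : ℝ} {p : ℝ → ℝ} (hp : Measurable p)
    (hp_pos : ∀ y, 0 < p y) (hj : DifferentiableOn ℂ j (V a b))
    (h : ∀ s ∈ V a b, Integrable (fun y : ℝ => cexp (s * y) * (p y : ℂ)) ∧
      j s = ∫ y : ℝ, cexp (s * y) * (p y : ℂ)) : IsAnalyticCharFun j a b := by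
  have h_density : Measurable fun y => ENNReal.ofReal (p y) := hp.ennreal_ofReal
  have h_lt_top : ∀ᵐ y : ℝ, ENNReal.ofReal (p y) < ⊤ := .of_forall fun y => ENNReal.ofReal_lt_top
  have h_smul (s : ℂ) (y : ℝ) : (ENNReal.ofReal (p y)).toReal • cexp (s * y) =
      cexp (s * y) * (p y : ℂ) := by
    rw [ENNReal.toReal_ofReal (hp_pos y).le, Complex.real_smul, mul_comm]
  refine ⟨hj, volume.withDensity fun y => ENNReal.ofReal (p y), fun h_zero => ?_, fun s hs => ?_⟩
  · rw [withDensity_eq_zero_iff h_density.aemeasurable] at h_zero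
    obtain ⟨y, hy⟩ := h_zero.exists
    exact (hp_pos y).not_ge (ENNReal.ofReal_eq_zero.1 hy)
  · rw [integrable_withDensity_iff_integrable_smul' h_density h_lt_top,
      integral_withDensity_eq_integral_toReal_smul h_density h_lt_top]
    simpa only [h_smul] using h s hs

theorem isAnalyticCharFun_or_neg {h : ℂ → ℂ} {a b : ℝ} (k : ℕ)
    (hk : IsAnalyticCharFun (fun z => (-1) ^ k * h z) a b) :
    IsAnalyticCharFun h a b ∨ IsAnalyticCharFun (fun z => -h z) a b := by
  rcases neg_one_pow_eq_or ℂ k with h_even | h_odd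
  · exact .inl (by simpa only [h_even, one_mul] using hk)
  · exact .inr (by simpa only [h_odd, neg_one_mul] using hk)

theorem eq_add_one_of_forall_n_ne_zero {β : ℂ} {k l : ℤ} (hkl : k < l)
    (h : ∀ x : ℝ, 4 * (k : ℝ) < x → x < 4 * l → n x β ≠ 0) : l = k + 1 := by
  by_contra h_ne
  have h_lt : (k + 1 : ℝ) < l := mod_cast (by omega : k + 1 < l)
  refine h (4 * (k + 1)) (by linarith) (by linarith) ?_
  exact_mod_cast n_four_mul (k + 1) β

/-- Rounding to a multiple of `4` within `D` transfers unboundedness from `D ∩ ℝ` to the zeros of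
`n`, which on `D` are exactly these multiples. -/
theorem isMeromorphicCharFunOn_f {β : ℂ} {D : Set ℂ} (h_xi : ∀ s ∈ D, xi (2 * β + s) ≠ 0)
    (h_zero : (0 : ℂ) ∉ D)
    (h_floor : ∀ x : ℝ, (x : ℂ) ∈ D → ((4 * ⌊x / 4⌋ : ℝ) : ℂ) ∈ D)
    (h_ceil : ∀ x : ℝ, (x : ℂ) ∈ D → ((4 * ⌈x / 4⌉ : ℝ) : ℂ) ∈ D)
    (h_strip : ∀ m : ℤ, ((4 * m : ℝ) : ℂ) ∈ D → ((4 * (m + 1) : ℝ) : ℂ) ∈ D →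
      IsAnalyticCharFun (fun s => f s β) (4 * m) (4 * (m + 1)) ∨
        IsAnalyticCharFun (fun s => -f s β) (4 * m) (4 * (m + 1))) :
    IsMeromorphicCharFunOn (fun s => f s β) D := by
  have h_n (m : ℤ) : n ((4 * m : ℝ) : ℂ) β = 0 := mod_cast n_four_mul m β
  have h_real {x : ℝ} (hx : (x : ℂ) ∈ D) (hx_zero : n x β = 0) : ∃ m : ℤ, x = 4 * m := by
    exact_mod_cast (n_eq_zero_iff (h_xi _ hx)).1 hx_zero
  refine ⟨fun s => n s β, differentiable_n β, fun z => rfl, fun z hz hz_zero => .inl ?_,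
    fun h => absurd h h_zero, mt fun ⟨B, hB⟩ => ⟨B, fun x hx => ?_⟩,
    mt fun ⟨B, hB⟩ => ⟨B, fun x hx => ?_⟩,
    fun x hx => deriv_n_ne_zero (h_xi _ hx), fun a b hab ha hb _ ha_zero hb_zero h_between => ?_⟩
  · obtain ⟨m, rfl⟩ := (n_eq_zero_iff (h_xi _ hz)).1 hz_zero
    simp
  · have := hB ⟨h_ceil x hx, h_n _⟩
    linarith [Int.le_ceil (x / 4)]
  · have := hB ⟨h_floor x hx, h_n _⟩
    linarith [Int.floor_le (x / 4)]
  · obtain ⟨k, rfl⟩ := h_real ha ha_zero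
    obtain ⟨l, rfl⟩ := h_real hb hb_zero
    have hkl : k < l := by
      rw [mul_lt_mul_iff_right₀ four_pos] at hab
      exact_mod_cast hab
    obtain rfl := eq_add_one_of_forall_n_ne_zero hkl h_between
    rw [Int.cast_add, Int.cast_one] at hb ⊢
    exact h_strip k ha hb

end CharFun

section RightHalfPlane

variable {β : ℝ} {w : ℕ}

theorem isAnalyticCharFun_f (hβ : 0 ≤ β) (hw : 1 ≤ w) :
    IsAnalyticCharFun (fun s => (-1) ^ w * f s β) (4 * w) (4 * (w + 1)) := by
  have h_measurable := (isMasterKernel_realP hβ hw).measurable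
  refine isAnalyticCharFun_of_density (p := fun y => realP w β (π * Real.exp (-2 * y)))
    (by fun_prop) (fun y => realP_pos hβ hw (by positivity))
    ((differentiableOn_f_V hβ hw).const_mul _) fun s hs => ?_
  simpa only [P_ofReal hβ] using integrable_and_f_eq_integral hβ hw hs

theorem isMeromorphicCharFunOn_f_re (hβ : 0 ≤ β) :
    IsMeromorphicCharFunOn (fun s => f s β) {s | 4 ≤ s.re} := by
  have h_round {x : ℝ} (hx : 4 ≤ x) : 1 ≤ ⌊x / 4⌋ := Int.le_floor.2 (by push_cast; linarith)
  have h_mem {m : ℤ} (hm : 1 ≤ m) : ((4 * m : ℝ) : ℂ) ∈ {s : ℂ | 4 ≤ s.re} := by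
    have : (1 : ℝ) ≤ m := mod_cast hm
    rw [mem_ofPred_eq, ofReal_re]
    linarith
  refine isMeromorphicCharFunOn_f
    (fun s hs => xi_two_mul_add_ne_zero hβ (lt_of_lt_of_le (by norm_num) hs)) (by simp)
    (fun x hx => h_mem (h_round hx))
    (fun x hx => h_mem ((h_round hx).trans (Int.floor_le_ceil _))) fun m hm _ => ?_
  have hm : 1 ≤ m := by
    rw [mem_ofPred_eq, ofReal_re, le_mul_iff_one_le_right four_pos] at hm
    exact_mod_cast hm
  lift m to ℕ using by omega
  exact isAnalyticCharFun_or_neg m (isAnalyticCharFun_f hβ (by omega))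

end RightHalfPlane

section Quarter

variable {w : ℕ} {s : ℂ}

theorem xi_quarter_neg (s : ℂ) : xi (2 * (1 / 4 : ℝ) + -s) = xi (2 * (1 / 4 : ℝ) + s) := by
  rw [← xi_one_sub]
  push_cast
  ring_nf

theorem f_quarter_neg (s : ℂ) : f (-s) (1 / 4 : ℝ) = -f s (1 / 4 : ℝ) := by
  rw [f, f, n, n, xi_quarter_neg, mul_neg, neg_div, Complex.sin_neg, neg_mul, div_neg]

theorem neg_mem_V {a b : ℝ} (hs : s ∈ V (-b) (-a)) : -s ∈ V a b :=
  ⟨lt_neg.1 hs.2, neg_lt.1 hs.1⟩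

theorem integrable_and_f_quarter_eq_integral (hw : 1 ≤ w) (hs : s ∈ V (-4 * (w + 1)) (-4 * w)) :
    Integrable (fun y : ℝ => cexp (s * y) * P w ((π * Real.exp (2 * y) : ℝ) : ℂ) (1 / 4 : ℝ)) ∧
      (-1) ^ (w + 1) * f s (1 / 4 : ℝ) =
        ∫ y : ℝ, cexp (s * y) * P w ((π * Real.exp (2 * y) : ℝ) : ℂ) (1 / 4 : ℝ) := by
  rw [neg_mul, neg_mul] at hs
  obtain ⟨h_integrable, h_integral⟩ :=
    integrable_and_f_eq_integral (β := 1 / 4) (by norm_num) hw (neg_mem_V hs)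
  have h_reflect (y : ℝ) : cexp (-s * (-y : ℝ)) *
      P w ((π * Real.exp (-2 * -y) : ℝ) : ℂ) (1 / 4 : ℝ) =
      cexp (s * y) * P w ((π * Real.exp (2 * y) : ℝ) : ℂ) (1 / 4 : ℝ) := by
    rw [neg_mul_neg, ofReal_neg, neg_mul_neg]
  constructor
  · simpa only [h_reflect] using h_integrable.comp_neg
  · rw [f_quarter_neg, ← integral_neg_eq_self] at h_integral
    simp only [h_reflect] at h_integral
    rw [← h_integral, pow_succ]
    ring

theorem differentiableOn_f_quarter (hw : 1 ≤ w) :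
    DifferentiableOn ℂ (fun s => f s (1 / 4 : ℝ)) (V (-4 * (w + 1)) (-4 * w)) := by
  have h_right := differentiableOn_f_V (β := 1 / 4) (by norm_num) hw
  refine (h_right.comp differentiable_neg.differentiableOn fun s hs =>
    neg_mem_V (by rwa [neg_mul, neg_mul] at hs)).neg.congr fun s _ => ?_
  simp only [Pi.neg_apply, Function.comp_apply, f_quarter_neg, neg_neg]

theorem isAnalyticCharFun_f_quarter (hw : 1 ≤ w) :
    IsAnalyticCharFun (fun s => (-1) ^ (w + 1) * f s (1 / 4 : ℝ)) (-4 * (w + 1)) (-4 * w) := by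
  have hβ : (0 : ℝ) ≤ 1 / 4 := by norm_num
  have h_measurable := (isMasterKernel_realP hβ hw).measurable
  refine isAnalyticCharFun_of_density (p := fun y => realP w (1 / 4) (π * Real.exp (2 * y)))
    (by fun_prop) (fun y => realP_pos hβ hw (by positivity))
    ((differentiableOn_f_quarter hw).const_mul _) fun s hs => ?_
  simpa only [P_ofReal hβ] using integrable_and_f_quarter_eq_integral hw hs

theorem xi_quarter_ne_zero (hs : 4 ≤ |s.re|) : xi (2 * (1 / 4 : ℝ) + s) ≠ 0 := by
  rcases le_abs.1 hs with h | h
  · exact xi_two_mul_add_ne_zero (by norm_num) (by linarith)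
  · rw [← xi_quarter_neg]
    exact xi_two_mul_add_ne_zero (by norm_num) (by rw [neg_re]; linarith)

theorem isAnalyticCharFun_f_quarter_or_neg {m : ℤ} (hm_zero : m ≠ 0) (hm_neg_one : m ≠ -1) :
    IsAnalyticCharFun (fun s => f s (1 / 4 : ℝ)) (4 * m) (4 * (m + 1)) ∨
      IsAnalyticCharFun (fun s => -f s (1 / 4 : ℝ)) (4 * m) (4 * (m + 1)) := by
  rcases lt_or_gt_of_ne hm_zero with h_neg | h_pos
  · obtain ⟨w, rfl⟩ : ∃ w : ℕ, m = -(w + 1) := ⟨(-(m + 1)).toNat, by omega⟩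
    refine isAnalyticCharFun_or_neg (w + 1) ?_
    convert! isAnalyticCharFun_f_quarter (w := w) (by omega) using 1 <;> push_cast <;> ring
  · lift m to ℕ using h_pos.le
    exact isAnalyticCharFun_or_neg m (isAnalyticCharFun_f (by norm_num) (by omega))

theorem isMeromorphicCharFunOn_f_quarter_abs_re :
    IsMeromorphicCharFunOn (fun s => f s (1 / 4 : ℝ)) {s | 4 ≤ |s.re|} := by
  have h_mem_iff (m : ℤ) : ((4 * m : ℝ) : ℂ) ∈ {s : ℂ | 4 ≤ |s.re|} ↔ m ≠ 0 := by
    rw [mem_ofPred_eq, ofReal_re, abs_mul, abs_of_pos (four_pos (α := ℝ)),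
      le_mul_iff_one_le_right four_pos, ← abs_pos, ← Order.one_le_iff_pos]
    norm_cast
  refine isMeromorphicCharFunOn_f (fun s => xi_quarter_ne_zero) (by simp)
    (fun x hx => (h_mem_iff _).2 ?_) (fun x hx => (h_mem_iff _).2 ?_) fun m hm hm_succ => ?_
  · intro h_floor
    obtain ⟨h_nonneg, h_lt⟩ := Int.floor_eq_zero_iff.1 h_floor
    rw [mem_ofPred_eq, ofReal_re, abs_of_nonneg (by linarith)] at hx
    linarith
  · intro h_ceil
    obtain ⟨h_lt, h_nonpos⟩ := Int.ceil_eq_zero_iff.1 h_ceil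
    rw [mem_ofPred_eq, ofReal_re, abs_of_nonpos (by linarith)] at hx
    linarith
  · have hm_succ : m + 1 ≠ 0 := (h_mem_iff (m + 1)).1 (by rwa [Int.cast_add, Int.cast_one])
    exact isAnalyticCharFun_f_quarter_or_neg ((h_mem_iff m).1 hm) (by omega)

end Quarter

end ZetaLaplace

theorem lemma6p2 (β : ℝ) (hβ : 0 ≤ β) :
    -- the series defining `P_{4w}(z, β)` converges absolutely, `P_{4w}(v, β)` is real for real `v`,
    -- vanishes at `0`, and is strictly increasing on `[0, π]`
    (∀ w : ℕ,
      (∀ z : ℂ, Summable fun j : ℕ => ‖ZetaLaplace.PTerm z β (w + 1 + j)‖) ∧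
      (∀ v : ℝ, (ZetaLaplace.P w v β).im = 0) ∧
      ZetaLaplace.P w 0 β = 0 ∧
      StrictMonoOn (fun v : ℝ => (ZetaLaplace.P w v β).re) (Set.Icc 0 Real.pi)) ∧
    -- for `w ≥ 1`: positivity
    (∀ w : ℕ, 1 ≤ w → ∀ v : ℝ, 0 < v → 0 < (ZetaLaplace.P w v β).re) ∧
    -- for `w ≥ 1`: `(-1)^w f(s, β)` is analytic on `V_{4w}` and is there the absolutely convergent
    -- Laplace transform of `P_{4w}(π e^{-2y}, β)`, which is positive
    (∀ w : ℕ, 1 ≤ w →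
      DifferentiableOn ℂ (fun s => ZetaLaplace.f s β) (ZetaLaplace.V (4 * w) (4 * (w + 1))) ∧
      (∀ y : ℝ, 0 < (ZetaLaplace.P w ((Real.pi * Real.exp (-2 * y) : ℝ) : ℂ) β).re) ∧
      ∀ s ∈ ZetaLaplace.V (4 * w) (4 * (w + 1)),
        MeasureTheory.Integrable (fun y : ℝ =>
          Complex.exp (s * y) * ZetaLaplace.P w ((Real.pi * Real.exp (-2 * y) : ℝ) : ℂ) β) ∧
        (-1) ^ w * ZetaLaplace.f s β = ∫ y : ℝ,
          Complex.exp (s * y) * ZetaLaplace.P w ((Real.pi * Real.exp (-2 * y) : ℝ) : ℂ) β) ∧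
    -- `f(s, β)` is a meromorphic characteristic function on `Re s ≥ 4`
    ZetaLaplace.IsMeromorphicCharFunOn (fun s => ZetaLaplace.f s β) {s | 4 ≤ s.re} ∧
    -- for `β = 1/4`: on the reflected strip `V_{4w'}`, `w' = -(w + 1)`, `w ≥ 1`, the function
    -- `(-1)^{w'} f(s)` has the positive Laplace density `P_{4w}(π e^{2y})`, and `f(s)` is a
    -- meromorphic characteristic function on `|Re s| ≥ 4`
    (β = 1 / 4 →
      (∀ w : ℕ, 1 ≤ w → ∀ s ∈ ZetaLaplace.V (-4 * (w + 1)) (-4 * w),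
        MeasureTheory.Integrable (fun y : ℝ =>
          Complex.exp (s * y) * ZetaLaplace.P w ((Real.pi * Real.exp (2 * y) : ℝ) : ℂ) β) ∧
        (-1) ^ (w + 1) * ZetaLaplace.f s β = ∫ y : ℝ,
          Complex.exp (s * y) * ZetaLaplace.P w ((Real.pi * Real.exp (2 * y) : ℝ) : ℂ) β) ∧
      ZetaLaplace.IsMeromorphicCharFunOn (fun s => ZetaLaplace.f s β) {s | 4 ≤ |s.re|}) := by
  refine ⟨fun w => ⟨ZetaLaplace.summable_norm_PTerm hβ w, fun v => ?_, ?_, ?_⟩,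
    fun w hw v hv => ?_, fun w hw => ⟨ZetaLaplace.differentiableOn_f_V hβ hw, fun y => ?_,
      fun s hs => ZetaLaplace.integrable_and_f_eq_integral hβ hw hs⟩,
    ZetaLaplace.isMeromorphicCharFunOn_f_re hβ, ?_⟩
  · rw [ZetaLaplace.P_ofReal hβ, ofReal_im]
  · rw [← ofReal_zero, ZetaLaplace.P_ofReal hβ, ZetaLaplace.realP_zero]
  · simpa only [ZetaLaplace.P_ofReal hβ, ofReal_re] using ZetaLaplace.strictMonoOn_realP hβ w
  · rw [ZetaLaplace.P_ofReal hβ, ofReal_re]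
    exact ZetaLaplace.realP_pos hβ hw hv
  · rw [ZetaLaplace.P_ofReal hβ, ofReal_re]
    exact ZetaLaplace.realP_pos hβ hw (by positivity)
  · rintro rfl
    exact ⟨fun w hw s hs => ZetaLaplace.integrable_and_f_quarter_eq_integral hw hs,
      ZetaLaplace.isMeromorphicCharFunOn_f_quarter_abs_re⟩
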